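/- Let $0<p<q$ and $\tau=p/q\in(0,1)$. Let $\eta(t)=(\eta_x(t))_{x\in\mathbb Z}$, $t\ge 0$, be the asymmetric simple exclusion process (ASEP) on $\mathbb Z$ in which each particle jumps to the right at rate $p$ and to the left at rate $q$, jumps to occupied sites being forbidden; that is, $\eta$ is a c\`adl\`ag process on $\{0,1\}^{\mathbb Z}$ that solves the martingale problem for the generator $$Lf(\eta)=\sum_{x\in\mathbb Z}\bigl(p\,\eta_x(1-\eta_{x+1})+q\,(1-\eta_x)\eta_{x+1}\bigr)\bigl[f(\eta^{x,x+1})-f(\eta)\bigr],\qquad f \text{ a cylinder function},$$ where $\eta^{x,x+1}$ is $\eta$ with the contents of $x$ and $x+1$ swapped. Suppose that the initial condition is two-sided Bernoulli with densities $\rho_-,\rho_+\in[0,1]$ (in particular, both may be nonzero): the variables $\eta_x(0)$ are independent, with $\mathbb P[\eta_x(0)=1]=\rho_-$ for $x<0$ and $=\rho_+$ for $x\ge 0$. Let $Q(0,t)$ be the number of jumps of particles from $1$ to $0$ minus the number of jumps from $0$ to $1$ during $(0,t]$, and let $$N(x,t)=Q(0,t)+\begin{cases}\sum_{y=1}^{x}\eta_y(t),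 & x>0,\\ 0, & x=0,\\ -\sum_{y=x+1}^{0}\eta_y(t), & x<0.\end{cases}$$ Then for every $n$, all integers $x_1<\dots<x_n$ and all $t\ge0$, the variable $\prod_{i=1}^n\tau^{N(x_i,t)}$ is integrable, and the $\tau$-correlations $$\phi(x_1,\dots,x_n;t)=\Bigl\langle \prod_{i=1}^n\tau^{N(x_i,t)}\Bigr\rangle$$ satisfy the Kolmogorov forward equations of the ASEP with $n$ particles: for all $\mathbf x=(x_1<\dots<x_n)$ and all $t\ge 0$ (with the right derivative at $t=0$), $$\frac{d}{dt}\phi(\mathbf x;t)=\sum_{\mathbf y}\bigl(r(\mathbf y,\mathbf x)\,\phi(\mathbf y;t)-r(\mathbf x,\mathbf y)\,\phi(\mathbf x;t)\bigr),$$ where $\mathbf y$ runs over the integer vectors $y_1<\dots<y_n$, and $r(\mathbf x,\mathbf y)$ is the jump rate of the $n$-particle ASEP: it equals $p$ if $\mathbf y$ is obtained from $\mathbf x$ by moving one particle one step to the right, $q$ if $\mathbf y$ is obtained from $\mathbf x$ by moving one particle one step to the left, and $0$ otherwise. -/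

import Mathlib

open MeasureTheory ProbabilityTheory Set Filter Topology
open scoped NNReal

namespace ASEP

/-- A configuration of particles on `ℤ`: `η x = true` iff the site `x` is occupied. -/
abbrev Config : Type := ℤ → Bool

/-- The occupation number `η_x ∈ {0, 1}`. -/
def occ (η : Config) (x : ℤ) : ℤ := if η x = true then 1 else 0

/-- The configuration `η^{x,x+1}`, in which the contents of `x` and `x + 1` are swapped. -/
def exchange (η : Config) (x : ℤ) : Config := fun y => η (Equiv.swap x (x + 1) y)

/-- Cylinder functions: functions of the occupations of finitely many sites. -/
def IsCylinder (f : Config → ℝ) : Prop := ∃ A : Finset ℤ, DependsOn f (A : Set ℤ)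

/-- The ASEP generator on cylinder functions (jumps to the right at rate `p`, to the left at
rate `q`). For a cylinder function `f` only finitely many terms of the sum are nonzero. -/
noncomputable def generator (p q : ℝ) (f : Config → ℝ) (η : Config) : ℝ :=
  ∑ᶠ x : ℤ, (p * (occ η x : ℝ) * (1 - (occ η (x + 1) : ℝ))
    + q * (1 - (occ η x : ℝ)) * (occ η (x + 1) : ℝ)) * (f (exchange η x) - f η)

/-- `η` is an ASEP on `ℤ` with right jump rate `p` and left jump rate `q`: an adapted càdlàg
process with values in `{0,1}^ℤ` (product topology) that solves the martingale problem of the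
ASEP generator on cylinder functions. -/
structure IsASEP {Ω : Type*} {mΩ : MeasurableSpace Ω} (p q : ℝ) (ℱ : Filtration ℝ≥0 mΩ)
    (P : Measure Ω) (η : ℝ≥0 → Ω → Config) : Prop where
  adapted : ∀ t, Measurable[ℱ t] (η t)
  right_continuous : ∀ ω t, ContinuousWithinAt (fun s => η s ω) (Ici t) t
  left_limits : ∀ ω t, ∃ l : Config, Tendsto (fun s => η s ω) (𝓝[<] t) (𝓝 l)
  martingale : ∀ f : Config → ℝ, IsCylinder f →
    Martingale (fun (t : ℝ≥0) (ω : Ω) =>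
      f (η t ω) - ∫ s in (0 : ℝ)..(t : ℝ), generator p q f (η s.toNNReal ω)) ℱ P

/-- The two-sided Bernoulli law: all sites are independent, a site `x < 0` is occupied with
probability `ρm` and a site `x ≥ 0` with probability `ρp`. -/
def IsTwoSidedBernoulli {Ω : Type*} [MeasurableSpace Ω] (ρm ρp : ℝ) (P : Measure Ω)
    (ξ : Ω → Config) : Prop :=
  iIndepFun (fun (x : ℤ) (ω : Ω) => ξ ω x) P ∧
    ∀ x : ℤ, P.real {ω | ξ ω x = true} = if x < 0 then ρm else ρp

/-- The times `s ∈ (0, t]` at which, along the trajectory `γ`, a particle jumps from the site `x`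
to the site `y`: just before `s` the site `x` is occupied and `y` is empty, at time `s` it is the
other way round. -/
def jumpTimes (γ : ℝ≥0 → Config) (x y : ℤ) (t : ℝ≥0) : Set ℝ≥0 :=
  {s | 0 < s ∧ s ≤ t ∧ (∀ᶠ r in 𝓝[<] s, γ r x = true ∧ γ r y = false) ∧
    γ s x = false ∧ γ s y = true}

/-- The time-integrated current `Q(x,t)` through the bond `(x, x+1)`, counted positively from
right to left. (For a càdlàg trajectory the two sets are finite.) -/
noncomputable def current (γ : ℝ≥0 → Config) (x : ℤ) (t : ℝ≥0) : ℤ :=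
  ((jumpTimes γ (x + 1) x t).ncard : ℤ) - ((jumpTimes γ x (x + 1) t).ncard : ℤ)

/-- The height function `N(x,t)`: `Q(0,t)` plus the number of particles in `{1, …, x}` at time
`t` if `x ≥ 0`, minus the number of particles in `{x+1, …, 0}` if `x ≤ 0`. -/
noncomputable def height (γ : ℝ≥0 → Config) (x : ℤ) (t : ℝ≥0) : ℤ :=
  current γ 0 t + ∑ y ∈ Finset.Icc 1 x, occ (γ t) y - ∑ y ∈ Finset.Icc (x + 1) 0, occ (γ t) y

/-- The states of the ASEP with `n` particles: positions `x₁ < ⋯ < xₙ`. -/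
abbrev Positions (n : ℕ) : Type := {x : Fin n → ℤ // StrictMono x}

/-- The product `∏ᵢ τ^{N(xᵢ,t)}` along a trajectory. -/
noncomputable def tauProduct (τ : ℝ) (γ : ℝ≥0 → Config) {n : ℕ} (x : Positions n) (t : ℝ≥0) : ℝ :=
  ∏ i, τ ^ height γ (x.1 i) t

/-- The `τ`-correlation `φ(x₁,…,xₙ;t) = ⟨τ^{N(x₁,t)} ⋯ τ^{N(xₙ,t)}⟩`. -/
noncomputable def tauCorrelation {Ω : Type*} [MeasurableSpace Ω] (τ : ℝ) (P : Measure Ω)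
    (η : ℝ≥0 → Ω → Config) {n : ℕ} (x : Positions n) (t : ℝ≥0) : ℝ :=
  ∫ ω, tauProduct τ (fun s => η s ω) x t ∂P

/-- The transition rate of the `n`-particle ASEP from `x` to `y`: one of the particles moves by
one step to the right (rate `p`) or to the left (rate `q`). Exclusion is enforced by the state
space: moves that leave `Positions n` do not occur. -/
noncomputable def rate (p q : ℝ) {n : ℕ} (x y : Positions n) : ℝ :=
  ∑ i : Fin n, ((if y.1 = x.1 + Pi.single i 1 then p else 0)
    + (if y.1 = x.1 - Pi.single i 1 then q else 0))

/-- The Kolmogorov forward (master) equations of the `n`-particle ASEP on `t ≥ 0`: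
`d/dt u(x;t) = ∑_y (rate(y → x) u(y;t) - rate(x → y) u(x;t))`, with a one-sided derivative at
`t = 0`. Only finitely many `y` contribute to the sum. -/
def SatisfiesForwardEquations (p q : ℝ) {n : ℕ} (u : Positions n → ℝ≥0 → ℝ) : Prop :=
  ∀ (x : Positions n) (t : ℝ≥0),
    HasDerivWithinAt (fun s : ℝ => u x s.toNNReal)
      (∑ᶠ y : Positions n, (rate p q y x * u y t - rate p q x y * u x t)) (Ici 0) (t : ℝ)

end ASEP

/-!
The height function makes `∏ᵢ τ ^ N(xᵢ, t)` a function `F m ξ` of the pair formed by the current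
`m = Q(0, t)` and the configuration `ξ = η(t)`; it involves finitely many sites and grows at most
like `κ ^ |m|`. The proof has an analytic and an algebraic half.

*Analytic half.* The pair should be a Markov process whose generator is that of the exclusion
process, with the current updated at each exchange of the sites `0` and `1`
(`ASEP.augmentedGenerator`). The martingale problem, however, speaks of the configuration only. The
current is therefore reconstructed from the trajectory: a càdlàg path visits the states of the bond
`(0, 1)` in finitely many steps, so on a fine enough time grid the current is the sum of the jumps
visible at the grid times (`ASEP.IsCadlagPath.eventually_gridCurrent`). On a grid step of length
`δ`, conditionally on the present current and bond, the next value of `F` is a cylinder function of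
the configuration, and the martingale problem, applied to it and to its image under the generator,
gives its mean up to `O(δ²)` (`ASEP.IsASEP.abs_integral_step_sub_generator_le`). Applied to
`κ ^ |m|`, the step estimates also bound the exponential moments of the current. Summing over
the grid and refining it yields `E F(s + h) = E F(s) + h E (LF)(s) + O(h²)`, locally uniformly
(`ASEP.IsASEP.abs_mean_le`), hence the derivative of `E F`
(`ASEP.IsASEP.hasDerivWithinAt_mean`).

*Algebraic half.* A jump across the bond `(y, y + 1)` changes the height at `y` only. For
`τ = p / q` both sides of the forward equations therefore become
`(q - p) * ∑ᵢ (η_{xᵢ} - η_{xᵢ + 1}) * ∏ᵢ τ ^ N(xᵢ)` along each trajectory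
(`ASEP.augmentedGenerator_tauFunction_eq`); the moves that exclusion forbids cancel between
neighbouring particles (`ASEP.sum_exclusion`).
-/

namespace ASEP

/-! ### Jumps of càdlàg paths in a discrete space -/

/-- The times in `(0, t]` at which the path `u` jumps from the state `a` to the state `b`. -/
def transitionTimes {α : Type*} (u : ℝ≥0 → α) (a b : α) (t : ℝ≥0) : Set ℝ≥0 :=
  {s | 0 < s ∧ s ≤ t ∧ (∀ᶠ r in 𝓝[<] s, u r = a) ∧ u s = b}

/-- Càdlàg paths in a discrete space: locally constant to the right of each time, and eventually
constant on approach from the left. -/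
structure IsCadlagStep {α : Type*} (u : ℝ≥0 → α) : Prop where
  right : ∀ t, ∀ᶠ s in 𝓝[≥] t, u s = u t
  left : ∀ t, ∃ l, ∀ᶠ s in 𝓝[<] t, u s = l

section Paths

variable {α : Type*} {u : ℝ≥0 → α}

lemma mem_ball_of_between {r s z t : ℝ≥0} {e : ℝ} (hs : s ∈ Metric.ball r e)
    (ht : t ∈ Metric.ball r e) (h1 : s ≤ z) (h2 : z ≤ t) : z ∈ Metric.ball r e := by
  rw [Metric.mem_ball, NNReal.dist_eq, abs_lt] at *
  have h1' : (s : ℝ) ≤ z := h1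
  have h2' : (z : ℝ) ≤ t := h2
  constructor <;> linarith [hs.1, ht.2]

/-- Around each time there is a ball on which the path has at most one jump, at the centre. -/
lemma IsCadlagStep.exists_ball (hu : IsCadlagStep u) (r : ℝ≥0) :
    ∃ e > 0, ∃ l, ∀ z ∈ Metric.ball r e, (r ≤ z → u z = u r) ∧ (z < r → u z = l) := by
  obtain ⟨l, hl⟩ := hu.left r
  have h1 := eventually_nhdsWithin_iff.1 (hu.right r)
  have h2 := eventually_nhdsWithin_iff.1 hl
  obtain ⟨e, he, h⟩ := Metric.eventually_nhds_iff_ball.1 (h1.and h2)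
  exact ⟨e, he, l, fun z hz => h z hz⟩

/-- Away from the centre of such a ball the path is constant near each time, so it does not jump. -/
lemma eq_of_mem_transitionTimes {a b : α} (hab : a ≠ b) {r : ℝ≥0} {e : ℝ} {l : α}
    (h : ∀ z ∈ Metric.ball r e, (r ≤ z → u z = u r) ∧ (z < r → u z = l))
    {z t : ℝ≥0} (hz : z ∈ Metric.ball r e) (hzt : z ∈ transitionTimes u a b t) : z = r := by
  obtain ⟨h0, -, hl, hb⟩ := hzt
  by_contra hne
  have hball : ∀ᶠ y in 𝓝[<] z, y ∈ Metric.ball r e :=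
    mem_nhdsWithin_of_mem_nhds (Metric.isOpen_ball.mem_nhds hz)
  have : NeBot (𝓝[<] z) := nhdsLT_neBot_of_exists_lt ⟨0, h0⟩
  rcases lt_or_gt_of_ne hne with hlt | hgt
  · obtain ⟨y, hy1, hy2, hy3⟩ := (hball.and (hl.and self_mem_nhdsWithin)).exists
    have hy3 : y < z := hy3
    apply hab
    rw [← hy2, ← hb, (h y hy1).2 (hy3.trans hlt), (h z hz).2 hlt]
  · have : ∀ᶠ y in 𝓝[<] z, r < y := mem_nhdsWithin_of_mem_nhds (isOpen_Ioi.mem_nhds hgt)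
    obtain ⟨y, hy1, hy2, hy3⟩ := (hball.and (hl.and this)).exists
    apply hab
    rw [← hy2, ← hb, (h y hy1).1 hy3.le, (h z hz).1 (le_of_lt hgt)]

/-- By compactness of `[0, t]`: each time has a neighbourhood with at most one transition. -/
lemma IsCadlagStep.finite_transitionTimes (hu : IsCadlagStep u) {a b : α} (hab : a ≠ b)
    (t : ℝ≥0) : (transitionTimes u a b t).Finite := by
  have key : (transitionTimes u a b t ∩ Icc 0 t).Finite := by
    refine isCompact_Icc.induction_on (p := fun S => (transitionTimes u a b t ∩ S).Finite)
      (by simp) (fun S S' hSS' h => h.subset (by gcongr))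
      (fun S S' h h' => by rw [inter_union_distrib_left]; exact h.union h') ?_
    intro r _
    obtain ⟨e, he, l, h⟩ := hu.exists_ball r
    exact ⟨Metric.ball r e, mem_nhdsWithin_of_mem_nhds (Metric.ball_mem_nhds r he),
      (finite_singleton r).subset fun z hz => eq_of_mem_transitionTimes hab h hz.2 hz.1⟩
  exact key.subset fun z hz => ⟨hz, zero_le, hz.2.1⟩

open Classical in
/-- Within a ball that contains at most one jump, the transitions during `(s, t]` are visible from
the states at `s` and `t`. -/
lemma IsCadlagStep.ncard_transitionTimes_of_mem_ball (hu : IsCadlagStep u) {a b : α}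
    (hab : a ≠ b) {r : ℝ≥0} {e : ℝ} {l : α}
    (h : ∀ z ∈ Metric.ball r e, (r ≤ z → u z = u r) ∧ (z < r → u z = l))
    {s t : ℝ≥0} (hst : s ≤ t) (hs : s ∈ Metric.ball r e) (ht : t ∈ Metric.ball r e) :
    (transitionTimes u a b t).ncard =
      (transitionTimes u a b s).ncard + if u s = a ∧ u t = b then 1 else 0 := by
  have hsub : transitionTimes u a b s ⊆ transitionTimes u a b t :=
    fun z hz => ⟨hz.1, hz.2.1.trans hst, hz.2.2⟩
  -- The only transition that can occur during `(s, t]` is at the centre `r`.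
  have hnew : ∀ z ∈ transitionTimes u a b t, z ∉ transitionTimes u a b s →
      s < r ∧ r ≤ t ∧ z = r := by
    intro z hz hz'
    have hsz : s < z := by
      by_contra hcon
      exact hz' ⟨hz.1, not_lt.1 hcon, hz.2.2⟩
    have hzr := eq_of_mem_transitionTimes hab h
      (mem_ball_of_between hs ht hsz.le hz.2.1) hz
    subst hzr
    exact ⟨hsz, hz.2.1, rfl⟩
  by_cases hr : s < r ∧ r ≤ t
  · have hus : u s = l := (h s hs).2 hr.1
    have hut : u t = u r := (h t ht).1 hr.2
    have h0 : 0 < r := lt_of_le_of_lt zero_le hr.1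
    have hr_ball := mem_ball_of_between hs ht hr.1.le hr.2
    have hball : ∀ᶠ y in 𝓝[<] r, u y = l := by
      filter_upwards [mem_nhdsWithin_of_mem_nhds (Metric.isOpen_ball.mem_nhds hr_ball),
        self_mem_nhdsWithin] with y hy hy'
      exact (h y hy).2 hy'
    have : NeBot (𝓝[<] r) := nhdsLT_neBot_of_exists_lt ⟨0, h0⟩
    have hmem : r ∈ transitionTimes u a b t ↔ u s = a ∧ u t = b := by
      constructor
      · rintro ⟨-, -, hl, hb⟩
        obtain ⟨y, hy1, hy2⟩ := (hball.and hl).exists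
        exact ⟨by rw [hus, ← hy1, hy2], by rw [hut, hb]⟩
      · rintro ⟨h1, h2⟩
        exact ⟨h0, hr.2, hball.mono fun y hy => by rw [hy, ← hus, h1], by rw [← hut, h2]⟩
    have hrs : r ∉ transitionTimes u a b s := fun hcon => not_le.2 hr.1 hcon.2.1
    split_ifs with hc
    · rw [← ncard_insert_of_notMem hrs (hu.finite_transitionTimes hab s)]
      congr 1
      refine Subset.antisymm (fun z hz => ?_) (insert_subset (hmem.2 hc) hsub)
      by_cases hz' : z ∈ transitionTimes u a b s
      · exact mem_insert_of_mem _ hz'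
      · rw [(hnew z hz hz').2.2]; exact mem_insert _ _
    · rw [add_zero]
      congr 1
      refine Subset.antisymm (fun z hz => ?_) hsub
      by_contra hz'
      have := (hnew z hz hz').2.2
      subst this
      exact hc (hmem.1 hz)
  · have hust : u s = u t := by
      rcases lt_or_ge s r with h1 | h1
      · have h2 : t < r := by
          by_contra hcon
          exact hr ⟨h1, not_lt.1 hcon⟩
        rw [(h s hs).2 h1, (h t ht).2 h2]
      · rw [(h s hs).1 h1, (h t ht).1 (h1.trans hst)]
    rw [if_neg (by rintro ⟨h1, h2⟩; exact hab (by rw [← h1, hust, h2])), add_zero]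
    congr 1
    refine Subset.antisymm (fun z hz => ?_) hsub
    by_contra hz'
    have := hnew z hz hz'
    exact hr ⟨this.1, this.2.1⟩

/-- On a compact time interval, transitions can be counted by looking at the path at the end
points of sufficiently short time steps. -/
lemma IsCadlagStep.exists_mesh (hu : IsCadlagStep u) (T : ℝ≥0) :
    ∃ δ > (0 : ℝ), ∀ s t : ℝ≥0, s ≤ t → t ≤ T → dist t s < δ → ∃ r : ℝ≥0, ∃ e : ℝ, ∃ l,
      (∀ z ∈ Metric.ball r e, (r ≤ z → u z = u r) ∧ (z < r → u z = l)) ∧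
        s ∈ Metric.ball r e ∧ t ∈ Metric.ball r e := by
  choose e he l h using hu.exists_ball
  obtain ⟨δ, hδ, hc⟩ := lebesgue_number_lemma_of_metric (isCompact_Icc (a := (0 : ℝ≥0)) (b := T))
    (c := fun r => Metric.ball r (e r)) (fun _ => Metric.isOpen_ball)
    (fun r _ => mem_iUnion.2 ⟨r, Metric.mem_ball_self (he r)⟩)
  refine ⟨δ, hδ, fun s t hst htT hd => ?_⟩
  obtain ⟨r, hr⟩ := hc s ⟨zero_le, hst.trans htT⟩
  exact ⟨r, e r, l r, h r, hr (Metric.mem_ball_self hδ), hr hd⟩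

end Paths

/-! ### The current as a sum of increments over a fine partition -/

/-- The contents of the bond `(x, x + 1)`. -/
def bond (x : ℤ) (ξ : Config) : Bool × Bool := (ξ x, ξ (x + 1))

/-- The current through a bond whose contents change from `a` to `b` in a single jump: `1` if a
particle moves to the left, `-1` if it moves to the right, `0` otherwise. -/
def bondJump (a b : Bool × Bool) : ℤ :=
  if a = (false, true) ∧ b = (true, false) then 1
  else if a = (true, false) ∧ b = (false, true) then -1 else 0

lemma abs_bondJump_le (a b : Bool × Bool) : |bondJump a b| ≤ 1 := by
  unfold bondJump; split_ifs <;> simp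

lemma bondJump_self (a : Bool × Bool) : bondJump a a = 0 := by
  revert a; decide

lemma continuous_bond (x : ℤ) : Continuous (bond x) := by
  unfold bond; fun_prop

lemma current_eq (γ : ℝ≥0 → Config) (x : ℤ) (t : ℝ≥0) :
    current γ x t =
      ((transitionTimes (fun s => bond x (γ s)) (false, true) (true, false) t).ncard : ℤ)
      - ((transitionTimes (fun s => bond x (γ s)) (true, false) (false, true) t).ncard : ℤ) := by
  have h1 : jumpTimes γ (x + 1) x t =
      transitionTimes (fun s => bond x (γ s)) (false, true) (true, false) t := by
    ext s
    simp only [jumpTimes, transitionTimes, bond, Prod.mk.injEq, mem_ofPred_eq,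
      and_comm (a := γ _ (x + 1) = _)]
  have h2 : jumpTimes γ x (x + 1) t =
      transitionTimes (fun s => bond x (γ s)) (true, false) (false, true) t := by
    ext s
    simp only [jumpTimes, transitionTimes, bond, Prod.mk.injEq, mem_ofPred_eq]
  rw [current, h1, h2]

lemma current_zero (γ : ℝ≥0 → Config) (x : ℤ) : current γ x 0 = 0 := by
  have : ∀ x y, jumpTimes γ x y 0 = ∅ := by
    intro x y
    ext s
    simp only [jumpTimes, mem_ofPred_eq, mem_empty_iff_false, iff_false]
    rintro ⟨h1, h2, -⟩
    exact absurd h1 (not_lt.2 h2)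
  simp [current, this]

/-- Right-continuity and left limits of the trajectories of configurations. -/
def IsCadlagPath (γ : ℝ≥0 → Config) : Prop :=
  (∀ t, ContinuousWithinAt γ (Ici t) t) ∧ ∀ t, ∃ l : Config, Tendsto γ (𝓝[<] t) (𝓝 l)

lemma IsCadlagPath.isCadlagStep {γ : ℝ≥0 → Config} (hγ : IsCadlagPath γ) (x : ℤ) :
    IsCadlagStep (fun s => bond x (γ s)) where
  right t := by
    have h := ((continuous_bond x).tendsto (γ t)).comp (hγ.1 t)
    rw [nhds_discrete, tendsto_pure] at h
    exact h
  left t := by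
    obtain ⟨l, hl⟩ := hγ.2 t
    have h := ((continuous_bond x).tendsto l).comp hl
    rw [nhds_discrete, tendsto_pure] at h
    exact ⟨_, h⟩

/-- Over short time steps the increment of the current is read off from the end points. -/
lemma IsCadlagPath.exists_mesh_current {γ : ℝ≥0 → Config} (hγ : IsCadlagPath γ) (x : ℤ)
    (T : ℝ≥0) : ∃ δ > (0 : ℝ), ∀ s t : ℝ≥0, s ≤ t → t ≤ T → dist t s < δ →
      current γ x t = current γ x s + bondJump (bond x (γ s)) (bond x (γ t)) := by
  have hu := hγ.isCadlagStep x
  obtain ⟨δ, hδ, h⟩ := hu.exists_mesh T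
  refine ⟨δ, hδ, fun s t hst htT hd => ?_⟩
  obtain ⟨r, e, l, hball, hs, ht⟩ := h s t hst htT hd
  rw [current_eq, current_eq,
    hu.ncard_transitionTimes_of_mem_ball (by simp) hball hst hs ht,
    hu.ncard_transitionTimes_of_mem_ball (by simp) hball hst hs ht]
  unfold bondJump
  split_ifs with h1 h2 h2
  · exact absurd (h1.1.symm.trans h2.1) (by simp)
  · push_cast; ring
  · push_cast; ring
  · push_cast; ring

/-- The end points of the `M` steps that divide `[s, s + h]` evenly. -/
noncomputable def gridTime (s h : ℝ≥0) (M j : ℕ) : ℝ≥0 := s + j * (h / M)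

/-- The current through the bond `(0, 1)` as seen at the grid times only. -/
noncomputable def gridCurrent (γ : ℝ≥0 → Config) (s h : ℝ≥0) (M j : ℕ) : ℤ :=
  ∑ i ∈ Finset.range j,
    bondJump (bond 0 (γ (gridTime s h M i))) (bond 0 (γ (gridTime s h M (i + 1))))

lemma gridTime_zero (s h : ℝ≥0) (M : ℕ) : gridTime s h M 0 = s := by simp [gridTime]

lemma gridTime_self (s h : ℝ≥0) {M : ℕ} (hM : M ≠ 0) : gridTime s h M M = s + h := by
  have : (M : ℝ≥0) ≠ 0 := by exact_mod_cast hM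
  rw [gridTime]; field_simp

lemma gridTime_succ (s h : ℝ≥0) (M j : ℕ) :
    gridTime s h M (j + 1) = gridTime s h M j + h / M := by
  simp only [gridTime]; push_cast; ring

lemma gridTime_mono (s h : ℝ≥0) (M : ℕ) : Monotone (gridTime s h M) :=
  monotone_nat_of_le_succ fun j => by rw [gridTime_succ]; exact le_self_add

/-- Along each trajectory, a sufficiently fine grid sees every jump and recovers the current
exactly. -/
lemma IsCadlagPath.eventually_gridCurrent {γ : ℝ≥0 → Config} (hγ : IsCadlagPath γ)
    (s h : ℝ≥0) : ∀ᶠ M : ℕ in atTop,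
      current γ 0 s + gridCurrent γ s h M M = current γ 0 (s + h) := by
  obtain ⟨δ, hδ, H⟩ := hγ.exists_mesh_current 0 (s + h)
  have hlim : Tendsto (fun M : ℕ => (h : ℝ) / M) atTop (𝓝 0) :=
    tendsto_const_div_atTop_nhds_zero_nat _
  filter_upwards [hlim.eventually (gt_mem_nhds hδ), eventually_ne_atTop 0] with M hM hM0
  have key : ∀ j ≤ M, current γ 0 s + gridCurrent γ s h M j = current γ 0 (gridTime s h M j) := by
    intro j
    induction j with
    | zero => intro _; simp [gridCurrent, gridTime_zero]
    | succ j ih =>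
      intro hj
      rw [gridCurrent, Finset.sum_range_succ, ← add_assoc]
      change current γ 0 s + gridCurrent γ s h M j + _ = _
      rw [ih (by omega)]
      refine (H _ _ (gridTime_mono s h M (Nat.le_succ j)) ?_ ?_).symm
      · rw [← gridTime_self s h hM0]; exact gridTime_mono s h M hj
      · rw [gridTime_succ, NNReal.dist_eq]
        push_cast
        rw [add_sub_cancel_left, abs_of_nonneg (by positivity)]
        exact hM
  rw [key M le_rfl, gridTime_self s h hM0]

/-! ### The generator on cylinder functions -/

/-- The rate at which the contents of the sites `x` and `x + 1` are exchanged. -/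
noncomputable def exchangeRate (p q : ℝ) (ξ : Config) (x : ℤ) : ℝ :=
  p * (occ ξ x : ℝ) * (1 - (occ ξ (x + 1) : ℝ)) + q * (1 - (occ ξ x : ℝ)) * (occ ξ (x + 1) : ℝ)

lemma abs_exchangeRate_le {p q : ℝ} (hp : 0 ≤ p) (hq : 0 ≤ q) (ξ : Config) (x : ℤ) :
    |exchangeRate p q ξ x| ≤ p + q := by
  unfold exchangeRate occ
  split_ifs <;> simp [abs_of_nonneg, hp, hq, add_nonneg]

/-- The sites of `W` together with their neighbours. -/
def enlarge (W : Finset ℤ) : Finset ℤ := W ∪ W.image (· + 1) ∪ W.image (· - 1)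

lemma subset_enlarge (W : Finset ℤ) : W ⊆ enlarge W := fun x hx => by simp [enlarge, hx]

lemma add_one_mem_enlarge {W : Finset ℤ} {x : ℤ} (hx : x ∈ W) : x + 1 ∈ enlarge W := by
  simp [enlarge, hx]

lemma swap_mem_enlarge {W : Finset ℤ} {y : ℤ} (hy : y ∈ W) (x : ℤ) :
    Equiv.swap x (x + 1) y ∈ enlarge W := by
  rcases eq_or_ne y x with rfl | h1
  · rw [Equiv.swap_apply_left]; exact add_one_mem_enlarge hy
  · rcases eq_or_ne y (x + 1) with rfl | h2
    · rw [Equiv.swap_apply_right]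
      simp only [enlarge, Finset.mem_union, Finset.mem_image]
      exact Or.inr ⟨x + 1, hy, by ring⟩
    · rw [Equiv.swap_apply_of_ne_of_ne h1 h2]; exact subset_enlarge W hy

lemma apply_exchange_eq_of_notMem {W : Finset ℤ} {f : Config → ℝ}
    (hf : DependsOn f (W : Set ℤ)) {x : ℤ} (hx : x ∉ enlarge W) (ξ : Config) :
    f (exchange ξ x) = f ξ := by
  refine hf fun y hy => ?_
  have h1 : y ≠ x := by rintro rfl; exact hx (subset_enlarge W hy)
  have h2 : y ≠ x + 1 := by
    rintro rfl
    apply hx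
    simp only [enlarge, Finset.mem_union, Finset.mem_image]
    exact Or.inr ⟨x + 1, hy, by ring⟩
  rw [exchange, Equiv.swap_apply_of_ne_of_ne h1 h2]

lemma generator_eq_sum {W : Finset ℤ} {f : Config → ℝ} (hf : DependsOn f (W : Set ℤ)) (p q : ℝ)
    (ξ : Config) :
    generator p q f ξ = ∑ x ∈ enlarge W, exchangeRate p q ξ x * (f (exchange ξ x) - f ξ) := by
  refine finsum_eq_sum_of_support_subset _ fun x hx => ?_
  by_contra hcon
  refine hx ?_
  beta_reduce
  rw [apply_exchange_eq_of_notMem hf hcon, sub_self, mul_zero]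

lemma dependsOn_generator {W : Finset ℤ} {f : Config → ℝ} (hf : DependsOn f (W : Set ℤ))
    (p q : ℝ) : DependsOn (generator p q f) (enlarge (enlarge W) : Set ℤ) := by
  intro ξ ζ h
  rw [generator_eq_sum hf, generator_eq_sum hf]
  refine Finset.sum_congr rfl fun x hx => ?_
  have h1 : ξ x = ζ x := h x (subset_enlarge _ hx)
  have h2 : ξ (x + 1) = ζ (x + 1) := h _ (add_one_mem_enlarge hx)
  have h3 : f ξ = f ζ := hf fun y hy => h y (subset_enlarge _ (subset_enlarge _ hy))
  have h4 : f (exchange ξ x) = f (exchange ζ x) :=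
    hf fun y hy => h _ (subset_enlarge _ (swap_mem_enlarge hy x))
  rw [exchangeRate, exchangeRate, occ, occ, occ, occ, h1, h2, h3, h4]

/-- A bound for the norm of the generator on the functions of the sites of `W`. -/
noncomputable def generatorBound (p q : ℝ) (W : Finset ℤ) : ℝ :=
  (enlarge W).card * ((p + q) * 2)

lemma generatorBound_nonneg {p q : ℝ} (hp : 0 ≤ p) (hq : 0 ≤ q) (W : Finset ℤ) :
    0 ≤ generatorBound p q W := by
  unfold generatorBound; positivity

lemma abs_generator_le {p q : ℝ} (hp : 0 ≤ p) (hq : 0 ≤ q) {W : Finset ℤ} {f : Config → ℝ}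
    (hf : DependsOn f (W : Set ℤ)) {B : ℝ} (hB : ∀ ξ, |f ξ| ≤ B) (ξ : Config) :
    |generator p q f ξ| ≤ generatorBound p q W * B := by
  rw [generator_eq_sum hf, generatorBound, mul_assoc, ← nsmul_eq_mul]
  refine (Finset.abs_sum_le_sum_abs _ _).trans (Finset.sum_le_card_nsmul _ _ _ fun x _ => ?_)
  rw [abs_mul, mul_assoc]
  refine mul_le_mul (abs_exchangeRate_le hp hq ξ x) ?_ (abs_nonneg _) (by positivity)
  calc |f (exchange ξ x) - f ξ| ≤ |f (exchange ξ x)| + |f ξ| := abs_sub _ _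
    _ ≤ 2 * B := by linarith [hB (exchange ξ x), hB ξ]

lemma continuous_of_dependsOn {E : Type*} [TopologicalSpace E] [Nonempty E] {W : Finset ℤ}
    {f : Config → E} (hf : DependsOn f (W : Set ℤ)) : Continuous f := by
  obtain ⟨g, rfl⟩ := dependsOn_iff_exists_comp.1 hf
  refine continuous_of_discreteTopology.comp ?_
  unfold Set.domRestrict
  fun_prop

/-! ### Consequences of the martingale problem -/

/-- A process with right-continuous paths is jointly measurable. -/
lemma measurable_uncurry_of_rightContinuous {Ω : Type*} [MeasurableSpace Ω]
    {X : ℝ≥0 → Ω → ℝ} (hX : ∀ t, Measurable (X t))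
    (hc : ∀ ω t, ContinuousWithinAt (fun s => X s ω) (Ici t) t) :
    Measurable (Function.uncurry X) := by
  -- Evaluate at the first multiple of `1 / (n + 1)` strictly to the right of `r`.
  let a : ℕ → ℝ≥0 → ℝ≥0 := fun n r => ((⌊r * (n + 1)⌋₊ : ℝ≥0) + 1) / (n + 1)
  refine measurable_of_tendsto_metrizable (f := fun n z => X (a n z.1) z.2) (fun n => ?_) ?_
  · have h1 : Measurable fun z : ℕ × Ω => X (((z.1 : ℝ≥0) + 1) / (n + 1)) z.2 :=
      measurable_from_prod_countable_right fun k => by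
        dsimp only
        exact hX _
    have h2 : Measurable fun z : ℝ≥0 × Ω => (⌊z.1 * (n + 1)⌋₊, z.2) :=
      (Nat.measurable_floor.comp (measurable_fst.mul_const _)).prodMk measurable_snd
    simpa only [Function.comp_def] using h1.comp h2
  · rw [tendsto_pi_nhds]
    rintro ⟨r, ω⟩
    have ha1 : ∀ n, r ≤ a n r := fun n => by
      rw [le_div_iff₀ (by positivity)]
      exact (Nat.lt_floor_add_one _).le
    have ha2 : ∀ n, a n r ≤ r + 1 / ((n : ℝ≥0) + 1) := fun n => by
      rw [div_le_iff₀ (by positivity), add_mul, one_div, inv_mul_cancel₀ (by positivity)]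
      gcongr
      exact Nat.floor_le zero_le
    have h0 : Tendsto (fun n : ℕ => r + 1 / ((n : ℝ≥0) + 1)) atTop (𝓝 r) := by
      have := (tendsto_one_div_add_atTop_nhds_zero_nat (𝕜 := ℝ≥0)).const_add r
      rwa [add_zero] at this
    have h1 : Tendsto (fun n => a n r) atTop (𝓝[≥] r) :=
      tendsto_nhdsWithin_iff.2 ⟨tendsto_of_tendsto_of_tendsto_of_le_of_le tendsto_const_nhds h0
        ha1 ha2, Eventually.of_forall ha1⟩
    exact (hc ω r).tendsto.comp h1

/-- Fubini: a bound for the set integrals of a process bounds those of its time integral. -/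
lemma abs_setIntegral_intervalIntegral_le {Ω : Type*} [MeasurableSpace Ω] {P : Measure Ω}
    [IsFiniteMeasure P] {Y : ℝ → Ω → ℝ} (hY : Measurable (Function.uncurry Y)) {b : ℝ}
    (hb : ∀ r ω, |Y r ω| ≤ b) {A : Set Ω} {c s t : ℝ} (hst : s ≤ t)
    (hc : ∀ r ∈ Ioc s t, |∫ ω in A, Y r ω ∂P| ≤ c) :
    |∫ ω in A, (∫ r in s..t, Y r ω) ∂P| ≤ c * (t - s) := by
  have hint : Integrable (Function.uncurry fun ω r => Y r ω)
      ((P.restrict A).prod (volume.restrict (Ioc s t))) :=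
    Integrable.of_bound (C := b) (hY.comp measurable_swap).aestronglyMeasurable
      (Eventually.of_forall fun z => hb _ _)
  have h1 : ∫ ω in A, (∫ r in s..t, Y r ω) ∂P = ∫ r in s..t, (∫ ω in A, Y r ω ∂P) := by
    simp only [intervalIntegral.integral_of_le hst]
    exact integral_integral_swap hint
  rw [h1, ← abs_of_nonneg (sub_nonneg.2 hst)]
  exact intervalIntegral.norm_integral_le_of_norm_le_const (f := fun r => ∫ ω in A, Y r ω ∂P)
    fun r hr => hc r (by rwa [uIoc_of_le hst] at hr)

section Martingale

variable {Ω : Type*} {mΩ : MeasurableSpace Ω} {p q : ℝ} {ℱ : Filtration ℝ≥0 mΩ}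
  {P : Measure Ω} {η : ℝ≥0 → Ω → Config}

lemma IsASEP.isCadlagPath (hη : IsASEP p q ℱ P η) (ω : Ω) : IsCadlagPath (fun s => η s ω) :=
  ⟨hη.right_continuous ω, hη.left_limits ω⟩

lemma IsASEP.measurable (hη : IsASEP p q ℱ P η) (t : ℝ≥0) : Measurable (η t) :=
  (hη.adapted t).mono (ℱ.le t) le_rfl

lemma IsASEP.measurable_comp (hη : IsASEP p q ℱ P η) {W : Finset ℤ} {f : Config → ℝ}
    (hf : DependsOn f (W : Set ℤ)) (t : ℝ≥0) : Measurable fun ω => f (η t ω) :=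
  (continuous_of_dependsOn hf).measurable.comp (hη.measurable t)

lemma IsASEP.measurable_uncurry (hη : IsASEP p q ℱ P η) {W : Finset ℤ} {f : Config → ℝ}
    (hf : DependsOn f (W : Set ℤ)) :
    Measurable (Function.uncurry fun (r : ℝ) (ω : Ω) => f (η r.toNNReal ω)) := by
  have h := measurable_uncurry_of_rightContinuous (X := fun s ω => f (η s ω))
    (hη.measurable_comp hf) fun ω t =>
      (continuous_of_dependsOn hf).continuousAt.comp_continuousWithinAt (hη.right_continuous ω t)
  have h2 : Measurable fun z : ℝ × Ω => (z.1.toNNReal, z.2) := by fun_prop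
  exact h.comp h2

lemma IsASEP.intervalIntegrable (hη : IsASEP p q ℱ P η) {W : Finset ℤ} {f : Config → ℝ}
    (hf : DependsOn f (W : Set ℤ)) {B : ℝ} (hB : ∀ ξ, |f ξ| ≤ B) (ω : Ω) (a b : ℝ) :
    IntervalIntegrable (fun r : ℝ => f (η r.toNNReal ω)) volume a b := by
  have hm : Measurable fun r : ℝ => f (η r.toNNReal ω) :=
    (hη.measurable_uncurry hf).comp measurable_prodMk_right
  exact (intervalIntegrable_const (c := B)).mono_fun hm.aestronglyMeasurable
    (Eventually.of_forall fun r => (hB _).trans (le_abs_self _))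

variable [IsProbabilityMeasure P]

lemma IsASEP.integrable_comp (hη : IsASEP p q ℱ P η) {W : Finset ℤ} {f : Config → ℝ}
    (hf : DependsOn f (W : Set ℤ)) {B : ℝ} (hB : ∀ ξ, |f ξ| ≤ B) (t : ℝ≥0) :
    Integrable (fun ω => f (η t ω)) P :=
  Integrable.of_bound (hη.measurable_comp hf t).aestronglyMeasurable B
    (Eventually.of_forall fun _ => hB _)

lemma IsASEP.integrable_intervalIntegral (hη : IsASEP p q ℱ P η) {W : Finset ℤ}
    {f : Config → ℝ} (hf : DependsOn f (W : Set ℤ)) {B : ℝ} (hB : ∀ ξ, |f ξ| ≤ B) {a b : ℝ}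
    (hab : a ≤ b) : Integrable (fun ω => ∫ r in a..b, f (η r.toNNReal ω)) P := by
  refine Integrable.of_bound ?_ (B * |b - a|) (Eventually.of_forall fun ω =>
    intervalIntegral.norm_integral_le_of_norm_le_const fun r _ => hB _)
  simp only [intervalIntegral.integral_of_le hab]
  have hm : StronglyMeasurable (Function.uncurry fun (ω : Ω) (r : ℝ) => f (η r.toNNReal ω)) :=
    ((hη.measurable_uncurry hf).comp measurable_swap).stronglyMeasurable
  exact (hm.integral_prod_right (ν := volume.restrict (Ioc a b))).aestronglyMeasurable

/-- The martingale property between the times `s` and `s + h`, on the event `A`. -/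
lemma IsASEP.setIntegral_increment (hη : IsASEP p q ℱ P η) (hp : 0 ≤ p) (hq : 0 ≤ q)
    {W : Finset ℤ} {f : Config → ℝ}
    (hf : DependsOn f (W : Set ℤ)) {B : ℝ} (hB : ∀ ξ, |f ξ| ≤ B) (s h : ℝ≥0) {A : Set Ω}
    (hA : MeasurableSet[ℱ s] A) :
    ∫ ω in A, (f (η (s + h) ω) - f (η s ω)) ∂P =
      ∫ ω in A, (∫ r in (s : ℝ)..(s + h : ℝ), generator p q f (η r.toNNReal ω)) ∂P := by
  have hM := hη.martingale f ⟨W, hf⟩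
  have hL := fun ω a b => hη.intervalIntegrable (dependsOn_generator hf p q)
    (abs_generator_le hp hq hf hB) ω a b
  have h1 := hM.setIntegral_eq (le_self_add : s ≤ s + h) hA
  rw [← sub_eq_zero, ← integral_sub (hM.integrable _).integrableOn
    (hM.integrable _).integrableOn] at h1
  have h2 := hη.integrable_intervalIntegral (dependsOn_generator hf p q)
    (abs_generator_le hp hq hf hB) (le_add_of_nonneg_right h.2 : (s : ℝ) ≤ s + h)
  rw [← sub_eq_zero, ← integral_sub _ h2.integrableOn, ← neg_eq_zero, ← integral_neg, ← h1]
  · congr 1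
    ext ω
    have := intervalIntegral.integral_interval_sub_left (hL ω 0 (s + h : ℝ)) (hL ω 0 s)
    push_cast
    rw [← this]
    ring
  · exact ((hη.integrable_comp hf hB _).sub (hη.integrable_comp hf hB _)).integrableOn

/-- Over a time step of length `h` the conditional expectation of a cylinder function changes by
`O(h)`. -/
lemma IsASEP.abs_setIntegral_sub_le (hη : IsASEP p q ℱ P η) (hp : 0 ≤ p) (hq : 0 ≤ q)
    {W : Finset ℤ} {f : Config → ℝ}
    (hf : DependsOn f (W : Set ℤ)) {B : ℝ} (hB : ∀ ξ, |f ξ| ≤ B) (s h : ℝ≥0) {A : Set Ω}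
    (hA : MeasurableSet[ℱ s] A) :
    |∫ ω in A, (f (η (s + h) ω) - f (η s ω)) ∂P| ≤ generatorBound p q W * B * P.real A * h := by
  rw [hη.setIntegral_increment hp hq hf hB s h hA]
  have := abs_setIntegral_intervalIntegral_le (P := P) (A := A)
    (hη.measurable_uncurry (dependsOn_generator hf p q))
    (fun r ω => abs_generator_le hp hq hf hB _) (le_add_of_nonneg_right h.2 : (s : ℝ) ≤ s + h)
    (c := generatorBound p q W * B * P.real A) fun r _ =>
      norm_setIntegral_le_of_norm_le_const (f := fun ω => generator p q f (η r.toNNReal ω))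
        (measure_lt_top P A) fun ω _ => abs_generator_le hp hq hf hB _
  rwa [add_sub_cancel_left] at this

/-- Over a time step of length `h` the conditional expectation of a cylinder function `f` changes
by `h * L f + O(h ^ 2)`: the integrand `L f` of the compensator is itself a cylinder function. -/
lemma IsASEP.abs_setIntegral_sub_generator_le (hη : IsASEP p q ℱ P η) (hp : 0 ≤ p) (hq : 0 ≤ q)
    {W : Finset ℤ} {f : Config → ℝ}
    (hf : DependsOn f (W : Set ℤ)) {B : ℝ} (hB : ∀ ξ, |f ξ| ≤ B) (s h : ℝ≥0) {A : Set Ω}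
    (hA : MeasurableSet[ℱ s] A) :
    |∫ ω in A, (f (η (s + h) ω) - f (η s ω) - h * generator p q f (η s ω)) ∂P| ≤
      generatorBound p q (enlarge (enlarge W)) * (generatorBound p q W * B) * P.real A * h ^ 2 := by
  have hLd := dependsOn_generator hf p q
  have hLb := abs_generator_le hp hq hf hB
  have hsh : (s : ℝ) ≤ s + h := le_add_of_nonneg_right h.2
  set D := generatorBound p q (enlarge (enlarge W)) * (generatorBound p q W * B) * P.real A
  have hD : 0 ≤ D := by
    have := (abs_nonneg _).trans (hLb fun _ => true)
    have := generatorBound_nonneg hp hq (enlarge (enlarge W))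
    positivity
  have hLm := hη.measurable_uncurry hLd
  have hYm : Measurable (Function.uncurry fun (r : ℝ) (ω : Ω) =>
      generator p q f (η r.toNNReal ω) - generator p q f (η s ω)) :=
    hLm.sub ((hη.measurable_comp hLd s).comp measurable_snd)
  have key := abs_setIntegral_intervalIntegral_le (P := P) (A := A) hYm
    (b := generatorBound p q W * B + generatorBound p q W * B)
    (fun r ω => (abs_sub _ _).trans (add_le_add (hLb _) (hLb _))) hsh (c := D * h) fun r hr => by
      have h0 : s ≤ r.toNNReal := NNReal.le_toNNReal_of_coe_le hr.1.le
      have h1 := hη.abs_setIntegral_sub_le hp hq hLd hLb s (r.toNNReal - s) hA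
      rw [add_tsub_cancel_of_le h0] at h1
      refine h1.trans (mul_le_mul_of_nonneg_left ?_ hD)
      rw [NNReal.coe_sub h0, Real.coe_toNNReal r (s.2.trans hr.1.le)]
      linarith [hr.2]
  have h2 : ∀ ω, (∫ r in (s : ℝ)..(s + h : ℝ),
      (generator p q f (η r.toNNReal ω) - generator p q f (η s ω))) =
      (∫ r in (s : ℝ)..(s + h : ℝ), generator p q f (η r.toNNReal ω))
        - h * generator p q f (η s ω) := by
    intro ω
    rw [intervalIntegral.integral_sub (hη.intervalIntegrable hLd hLb ω _ _)
      intervalIntegrable_const, intervalIntegral.integral_const, add_sub_cancel_left, smul_eq_mul]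
  simp only [h2] at key
  have hi1 : IntegrableOn (fun ω => f (η (s + h) ω) - f (η s ω)) A P :=
    ((hη.integrable_comp hf hB _).sub (hη.integrable_comp hf hB _)).integrableOn
  have hi2 : IntegrableOn (fun ω => h * generator p q f (η s ω)) A P :=
    ((hη.integrable_comp hLd hLb _).const_mul _).integrableOn
  have hi3 := (hη.integrable_intervalIntegral hLd hLb hsh).integrableOn (s := A)
  rw [integral_sub hi1 hi2, hη.setIntegral_increment hp hq hf hB s h hA, ← integral_sub hi3 hi2]
  refine key.trans (le_of_eq ?_)
  ring

end Martingale

/-! ### Functions of the current and the configuration -/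

/-- The generator of the pair (current through the bond `(0, 1)`, configuration): an exchange of
the sites `0` and `1` also changes the current. -/
noncomputable def augmentedGenerator (p q : ℝ) (F : ℤ → Config → ℝ) (m : ℤ) (ξ : Config) : ℝ :=
  generator p q (fun ζ => F (m + bondJump (bond 0 ξ) (bond 0 ζ)) ζ) ξ

/-- Functions `F m ξ` of the current `m` and of the sites `W` of the configuration `ξ`, where `W`
contains the sites `0` and `1`, that grow at most like `B * κ ^ |m|`. -/
structure IsTempered (W : Finset ℤ) (κ B : ℝ) (F : ℤ → Config → ℝ) : Prop where
  zero_mem : (0 : ℤ) ∈ W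
  one_mem : (1 : ℤ) ∈ W
  dependsOn : ∀ m, DependsOn (F m) (W : Set ℤ)
  bound : ∀ m ξ, |F m ξ| ≤ B * κ ^ m.natAbs

section Tempered

variable {W : Finset ℤ} {κ B : ℝ} {F : ℤ → Config → ℝ}

lemma pow_natAbs_add_le (hκ : 1 ≤ κ) {m j : ℤ} (hj : |j| ≤ 1) :
    κ ^ (m + j).natAbs ≤ κ * κ ^ m.natAbs := by
  rw [← pow_succ']
  refine pow_le_pow_right₀ hκ ((Int.natAbs_add_le m j).trans ?_)
  have : j.natAbs ≤ 1 := by rw [Int.abs_eq_natAbs] at hj; exact_mod_cast hj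
  omega

lemma IsTempered.bound_nonneg (hF : IsTempered W κ B F) : 0 ≤ B := by
  have := (abs_nonneg _).trans (hF.bound 0 fun _ => true)
  simpa using this

lemma isTempered_weight (κ : ℝ) (hκ : 1 ≤ κ) :
    IsTempered {0, 1} κ 1 (fun m _ => κ ^ m.natAbs) where
  zero_mem := by simp
  one_mem := by simp
  dependsOn m := fun _ _ _ => rfl
  bound m ξ := by rw [one_mul, abs_of_nonneg (by positivity)]

lemma IsTempered.bond_eq (hF : IsTempered W κ B F) {ξ ζ : Config} (h : ∀ x ∈ W, ξ x = ζ x) :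
    bond 0 ξ = bond 0 ζ := by
  simp [bond, h 0 hF.zero_mem, h 1 hF.one_mem]

lemma IsTempered.dependsOn_shift (hF : IsTempered W κ B F) (m : ℤ) (b : Bool × Bool) :
    DependsOn (fun ζ => F (m + bondJump b (bond 0 ζ)) ζ) (W : Set ℤ) := by
  intro ξ ζ h
  dsimp only
  rw [hF.bond_eq h]
  exact hF.dependsOn _ h

lemma IsTempered.abs_shift_le (hF : IsTempered W κ B F) (hκ : 1 ≤ κ) (m : ℤ) (b : Bool × Bool)
    (ζ : Config) :
    |F (m + bondJump b (bond 0 ζ)) ζ| ≤ B * κ * κ ^ m.natAbs := by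
  refine (hF.bound _ _).trans ?_
  rw [mul_assoc]
  exact mul_le_mul_of_nonneg_left (pow_natAbs_add_le hκ (abs_bondJump_le _ _)) hF.bound_nonneg

lemma IsTempered.augmentedGenerator {p q : ℝ} (hp : 0 ≤ p) (hq : 0 ≤ q) (hκ : 1 ≤ κ)
    (hF : IsTempered W κ B F) :
    IsTempered (enlarge (enlarge W)) κ (generatorBound p q W * (B * κ))
      (augmentedGenerator p q F) where
  zero_mem := subset_enlarge _ (subset_enlarge _ hF.zero_mem)
  one_mem := subset_enlarge _ (subset_enlarge _ hF.one_mem)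
  dependsOn m := by
    intro ξ ζ h
    have hb : bond 0 ξ = bond 0 ζ :=
      hF.bond_eq fun x hx => h x (subset_enlarge _ (subset_enlarge _ hx))
    unfold ASEP.augmentedGenerator
    rw [hb]
    exact dependsOn_generator (hF.dependsOn_shift m (bond 0 ζ)) p q h
  bound m ξ := by
    rw [mul_assoc]
    exact abs_generator_le hp hq (hF.dependsOn_shift m (bond 0 ξ)) (hF.abs_shift_le hκ m _) ξ

end Tempered

/-! ### One step of the time grid -/

/-- An integral is bounded by bounding its parts over the fibres of a discrete random variable. -/
lemma abs_integral_le_of_fibers {Ω S : Type*} [MeasurableSpace Ω] [MeasurableSpace S]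
    [Countable S] [MeasurableSingletonClass S] {P : Measure Ω} {Z : Ω → S} (hZ : Measurable Z)
    {H : Ω → ℝ} (hH : Integrable H P) {c : S → ℝ} (hc : Integrable (fun ω => c (Z ω)) P)
    (h : ∀ z, |∫ ω in Z ⁻¹' {z}, H ω ∂P| ≤ c z * P.real (Z ⁻¹' {z})) :
    |∫ ω, H ω ∂P| ≤ ∫ ω, c (Z ω) ∂P := by
  have hm : ∀ z, MeasurableSet (Z ⁻¹' {z}) := fun z => hZ (measurableSet_singleton z)
  have hd : Pairwise (Function.onFun Disjoint fun z => Z ⁻¹' {z}) := fun a b hab =>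
    Disjoint.preimage _ (by simpa using hab)
  have hU : ⋃ z, Z ⁻¹' {z} = univ := by
    rw [← preimage_iUnion, iUnion_of_singleton, preimage_univ]
  have h1 := hasSum_integral_iUnion (μ := P) hm hd hH.integrableOn
  have h2 := hasSum_integral_iUnion (μ := P) hm hd hc.integrableOn
  rw [hU, setIntegral_univ] at h1 h2
  have h3 : ∀ z, ∫ ω in Z ⁻¹' {z}, c (Z ω) ∂P = c z * P.real (Z ⁻¹' {z}) := by
    intro z
    rw [setIntegral_congr_fun (g := fun _ => c z) (hm z)
      (fun ω hω => by rw [mem_preimage, mem_singleton_iff] at hω; simp only [hω]),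
      setIntegral_const, smul_eq_mul, mul_comm]
  simp only [h3] at h2
  exact abs_le.2 ⟨neg_le.1 (hasSum_le (fun z => neg_le.1 (abs_le.1 (h z)).1) h1.neg h2),
    hasSum_le (fun z => (abs_le.1 (h z)).2) h1 h2⟩

section OneStep

variable {Ω : Type*} {mΩ : MeasurableSpace Ω} {p q : ℝ} {ℱ : Filtration ℝ≥0 mΩ}
  {P : Measure Ω} {η : ℝ≥0 → Ω → Config}
  {W : Finset ℤ} {κ B : ℝ} {F : ℤ → Config → ℝ} {K : Ω → ℤ}

lemma IsASEP.measurable_tempered (hη : IsASEP p q ℱ P η) (hF : IsTempered W κ B F)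
    (hK : Measurable K) (t : ℝ≥0) : Measurable fun ω => F (K ω) (η t ω) := by
  have h : Measurable fun z : ℤ × Config => F z.1 z.2 :=
    measurable_from_prod_countable_right fun m => (continuous_of_dependsOn (hF.dependsOn m)).measurable
  exact h.comp (hK.prodMk (hη.measurable t))

lemma IsASEP.integrable_tempered (hη : IsASEP p q ℱ P η) (hF : IsTempered W κ B F)
    (hK : Measurable K) (hV : Integrable (fun ω => κ ^ (K ω).natAbs) P) (t : ℝ≥0) :
    Integrable (fun ω => F (K ω) (η t ω)) P :=
  (hV.const_mul B).mono' (hη.measurable_tempered hF hK t).aestronglyMeasurable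
    (Eventually.of_forall fun _ => hF.bound _ _)

lemma IsASEP.measurable_bondJump (hη : IsASEP p q ℱ P η) {s t u : ℝ≥0} (hs : s ≤ u)
    (ht : t ≤ u) :
    Measurable[ℱ u] fun ω => bondJump (bond 0 (η s ω)) (bond 0 (η t ω)) := by
  have h : Measurable fun z : (Bool × Bool) × (Bool × Bool) => bondJump z.1 z.2 :=
    measurable_of_countable _
  have hb := (continuous_bond 0).measurable
  exact h.comp ((hb.comp ((hη.adapted s).mono (ℱ.mono hs) le_rfl)).prodMk
    (hb.comp ((hη.adapted t).mono (ℱ.mono ht) le_rfl)))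

lemma integrable_weight_add (hκ : 1 ≤ κ) {J : Ω → ℤ} (hK : Measurable K) (hJ : Measurable J)
    (hJ1 : ∀ ω, |J ω| ≤ 1) (hV : Integrable (fun ω => κ ^ (K ω).natAbs) P) :
    Integrable (fun ω => κ ^ (K ω + J ω).natAbs) P := by
  refine (hV.const_mul κ).mono' ?_ (Eventually.of_forall fun ω => ?_)
  · exact ((measurable_of_countable fun m : ℤ => κ ^ m.natAbs).comp
      (hK.add hJ)).aestronglyMeasurable
  · rw [Real.norm_of_nonneg (by positivity)]
    exact pow_natAbs_add_le hκ (hJ1 ω)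

/-- The pair whose fibres are used below: on each of them the current at time `s + h`, hence any
function of that current, is determined by the configuration at time `s + h`. -/
lemma IsASEP.measurable_fiber (hη : IsASEP p q ℱ P η) {s : ℝ≥0} (hK : Measurable[ℱ s] K) :
    Measurable[ℱ s] fun ω => (K ω, bond 0 (η s ω)) :=
  hK.prodMk ((continuous_bond 0).measurable.comp (hη.adapted s))

variable [IsProbabilityMeasure P]

/-- Over one step the mean of a tempered function of current and configuration changes by
`O(h)`. -/
lemma IsASEP.abs_integral_step_le (hη : IsASEP p q ℱ P η) (hp : 0 ≤ p) (hq : 0 ≤ q) (hκ : 1 ≤ κ)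
    (hF : IsTempered W κ B F) (s h : ℝ≥0) (hK : Measurable[ℱ s] K)
    (hV : Integrable (fun ω => κ ^ (K ω).natAbs) P) :
    |∫ ω, F (K ω + bondJump (bond 0 (η s ω)) (bond 0 (η (s + h) ω))) (η (s + h) ω) ∂P
        - ∫ ω, F (K ω) (η s ω) ∂P| ≤
      generatorBound p q W * (B * κ) * h * ∫ ω, κ ^ (K ω).natAbs ∂P := by
  have hKm : Measurable K := hK.mono (ℱ.le s) le_rfl
  have hJ : Measurable fun ω => bondJump (bond 0 (η s ω)) (bond 0 (η (s + h) ω)) :=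
    (hη.measurable_bondJump le_self_add le_rfl).mono (ℱ.le _) le_rfl
  have hi1 := hη.integrable_tempered hF hKm hV s
  have hi2 := hη.integrable_tempered hF (hKm.add hJ)
    (integrable_weight_add hκ hKm hJ (fun _ => abs_bondJump_le _ _) hV) (s + h)
  have hZ := hη.measurable_fiber hK
  simp only [Pi.add_apply] at hi2
  rw [← integral_sub hi2 hi1, ← integral_const_mul]
  refine abs_integral_le_of_fibers (hZ.mono (ℱ.le s) le_rfl)
    (c := fun z => generatorBound p q W * (B * κ) * h * κ ^ z.1.natAbs) (hi2.sub hi1)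
    (hV.const_mul _) ?_
  -- With the current `m` and the bond contents `b` at time `s` fixed, the function of the next
  -- current and configuration is a cylinder function of the latter.
  rintro ⟨m, b⟩
  have hA := hZ (measurableSet_singleton (m, b))
  rw [setIntegral_congr_fun (ℱ.le s _ hA)
    (g := fun ω => F (m + bondJump b (bond 0 (η (s + h) ω))) (η (s + h) ω)
      - F (m + bondJump b (bond 0 (η s ω))) (η s ω)) fun ω hω => ?_]
  · refine (hη.abs_setIntegral_sub_le hp hq (hF.dependsOn_shift m b) (hF.abs_shift_le hκ m b)
      s h hA).trans (le_of_eq ?_)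
    ring
  · simp only [mem_preimage, mem_singleton_iff, Prod.mk.injEq] at hω
    simp only [Pi.sub_apply, hω.1, hω.2, bondJump_self, add_zero]

/-- Over one step the mean of a tempered function changes by `h` times the mean of its image under
the augmented generator, up to `O(h ^ 2)`. -/
lemma IsASEP.abs_integral_step_sub_generator_le (hη : IsASEP p q ℱ P η) (hp : 0 ≤ p)
    (hq : 0 ≤ q) (hκ : 1 ≤ κ)
    (hF : IsTempered W κ B F) (s h : ℝ≥0) (hK : Measurable[ℱ s] K)
    (hV : Integrable (fun ω => κ ^ (K ω).natAbs) P) :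
    |∫ ω, F (K ω + bondJump (bond 0 (η s ω)) (bond 0 (η (s + h) ω))) (η (s + h) ω) ∂P
        - ∫ ω, F (K ω) (η s ω) ∂P - h * ∫ ω, augmentedGenerator p q F (K ω) (η s ω) ∂P| ≤
      generatorBound p q (enlarge (enlarge W)) * (generatorBound p q W * (B * κ)) * h ^ 2 *
        ∫ ω, κ ^ (K ω).natAbs ∂P := by
  have hKm : Measurable K := hK.mono (ℱ.le s) le_rfl
  have hJ : Measurable fun ω => bondJump (bond 0 (η s ω)) (bond 0 (η (s + h) ω)) :=
    (hη.measurable_bondJump le_self_add le_rfl).mono (ℱ.le _) le_rfl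
  have hi1 := hη.integrable_tempered hF hKm hV s
  have hi2 := hη.integrable_tempered hF (hKm.add hJ)
    (integrable_weight_add hκ hKm hJ (fun _ => abs_bondJump_le _ _) hV) (s + h)
  have hi3 := (hη.integrable_tempered (hF.augmentedGenerator hp hq hκ) hKm hV s).const_mul (h : ℝ)
  have hZ := hη.measurable_fiber hK
  simp only [Pi.add_apply] at hi2
  have hi21 : Integrable (fun ω =>
      F (K ω + bondJump (bond 0 (η s ω)) (bond 0 (η (s + h) ω))) (η (s + h) ω)
        - F (K ω) (η s ω)) P := hi2.sub hi1
  rw [← integral_const_mul, ← integral_sub hi2 hi1, ← integral_sub hi21 hi3,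
    ← integral_const_mul]
  refine abs_integral_le_of_fibers (hZ.mono (ℱ.le s) le_rfl)
    (c := fun z => generatorBound p q (enlarge (enlarge W)) *
      (generatorBound p q W * (B * κ)) * h ^ 2 * κ ^ z.1.natAbs) (hi21.sub hi3)
    (hV.const_mul _) ?_
  -- With the current `m` and the bond contents `b` at time `s` fixed, the function of the next
  -- current and configuration is a cylinder function of the latter.
  rintro ⟨m, b⟩
  have hA := hZ (measurableSet_singleton (m, b))
  rw [setIntegral_congr_fun (ℱ.le s _ hA)
    (g := fun ω => F (m + bondJump b (bond 0 (η (s + h) ω))) (η (s + h) ω)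
      - F (m + bondJump b (bond 0 (η s ω))) (η s ω)
      - h * generator p q (fun ζ => F (m + bondJump b (bond 0 ζ)) ζ) (η s ω)) fun ω hω => ?_]
  · refine (hη.abs_setIntegral_sub_generator_le hp hq (hF.dependsOn_shift m b)
      (hF.abs_shift_le hκ m b) s h hA).trans (le_of_eq ?_)
    ring
  · simp only [mem_preimage, mem_singleton_iff, Prod.mk.injEq] at hω
    simp only [Pi.sub_apply, augmentedGenerator, hω.1, hω.2, bondJump_self, add_zero]

end OneStep

/-! ### Many steps of the time grid -/

/-- A discrete second-order Taylor estimate. -/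
lemma abs_sub_sub_le_of_steps {a b : ℕ → ℝ} {δ D : ℝ} (hδ : 0 ≤ δ) {M : ℕ}
    (ha : ∀ j < M, |a (j + 1) - a j - δ * b j| ≤ D * δ ^ 2)
    (hb : ∀ j < M, |b (j + 1) - b j| ≤ D * δ) :
    |a M - a 0 - M * δ * b 0| ≤ D * (M * δ) ^ 2 := by
  have h1 : ∀ j ≤ M, |b j - b 0| ≤ D * (j * δ) := by
    intro j
    induction j with
    | zero => intro _; simp
    | succ j ih =>
      intro hj
      have := abs_add_le (b (j + 1) - b j) (b j - b 0)
      rw [sub_add_sub_cancel] at this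
      push_cast
      linarith [ih (by omega), hb j hj]
  have h2 : ∀ j ≤ M, |a j - a 0 - j * δ * b 0| ≤ D * (j * δ) ^ 2 := by
    intro j
    induction j with
    | zero => intro _; simp
    | succ j ih =>
      intro hj
      have e : a (j + 1) - a 0 - ((j + 1 : ℕ) : ℝ) * δ * b 0 =
          (a (j + 1) - a j - δ * b j) + (a j - a 0 - j * δ * b 0) + δ * (b j - b 0) := by
        push_cast; ring
      have h3 : |δ * (b j - b 0)| ≤ δ * (D * (j * δ)) := by
        rw [abs_mul, abs_of_nonneg hδ]
        exact mul_le_mul_of_nonneg_left (h1 j (by omega)) hδ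
      have h4 : 0 ≤ δ * (D * (j * δ)) := (abs_nonneg _).trans h3
      rw [e]
      refine (abs_add_three _ _ _).trans ?_
      push_cast
      nlinarith [ih (by omega), ha j hj]
  exact h2 M le_rfl

section Grid

variable {Ω : Type*} {mΩ : MeasurableSpace Ω} {p q : ℝ} {ℱ : Filtration ℝ≥0 mΩ}
  {P : Measure Ω} {η : ℝ≥0 → Ω → Config}
  {W : Finset ℤ} {κ B : ℝ} {F : ℤ → Config → ℝ} {K : Ω → ℤ}

lemma gridCurrent_succ (γ : ℝ≥0 → Config) (s h : ℝ≥0) (M j : ℕ) :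
    gridCurrent γ s h M (j + 1) = gridCurrent γ s h M j +
      bondJump (bond 0 (γ (gridTime s h M j))) (bond 0 (γ (gridTime s h M j + h / M))) := by
  rw [gridCurrent, Finset.sum_range_succ, gridTime_succ, gridCurrent]

lemma IsASEP.measurable_gridCurrent (hη : IsASEP p q ℱ P η) (s h : ℝ≥0) (M j : ℕ) :
    Measurable[ℱ (gridTime s h M j)] fun ω => gridCurrent (fun r => η r ω) s h M j := by
  unfold gridCurrent
  refine Finset.measurable_fun_sum _ fun i hi => ?_
  rw [Finset.mem_range] at hi
  exact hη.measurable_bondJump (gridTime_mono s h M hi.le) (gridTime_mono s h M hi)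

lemma IsASEP.measurable_add_gridCurrent (hη : IsASEP p q ℱ P η) {s : ℝ≥0}
    (hK : Measurable[ℱ s] K) (h : ℝ≥0) (M j : ℕ) :
    Measurable[ℱ (gridTime s h M j)] fun ω => K ω + gridCurrent (fun r => η r ω) s h M j :=
  (hK.mono (ℱ.mono le_self_add) le_rfl).add (hη.measurable_gridCurrent s h M j)

lemma IsASEP.measurable_current (hη : IsASEP p q ℱ P η) (t : ℝ≥0) :
    Measurable[ℱ t] fun ω => current (fun r => η r ω) 0 t := by
  have hm : ∀ M : ℕ, Measurable[ℱ t] fun ω =>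
      gridCurrent (fun r => η r ω) 0 t (M + 1) (M + 1) := fun M => by
    have := hη.measurable_gridCurrent 0 t (M + 1) (M + 1)
    rwa [gridTime_self _ _ (Nat.succ_ne_zero M), zero_add] at this
  refine @measurable_of_tendsto_metrizable _ _ (ℱ t) _ _ _ _ _ _ hm ?_
  rw [tendsto_pi_nhds]
  intro ω
  have h1 := (tendsto_add_atTop_nat 1).eventually
    ((hη.isCadlagPath ω).eventually_gridCurrent 0 t)
  simp only [current_zero, zero_add] at h1
  exact tendsto_nhds_of_eventually_eq h1

variable [IsProbabilityMeasure P]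

/-- The exponential rate at which the mean of `κ ^ |current|` can grow. -/
noncomputable def growthRate (p q κ : ℝ) : ℝ := generatorBound p q {0, 1} * κ

lemma growthRate_nonneg (hp : 0 ≤ p) (hq : 0 ≤ q) (hκ : 1 ≤ κ) : 0 ≤ growthRate p q κ :=
  mul_nonneg (generatorBound_nonneg hp hq _) (by linarith)

/-- The step estimate for the weight `κ ^ |m|` itself: its mean grows by a factor
`1 + growthRate p q κ * δ` at most in each step of length `δ`. -/
lemma IsASEP.weight_gridCurrent (hη : IsASEP p q ℱ P η) (hp : 0 ≤ p) (hq : 0 ≤ q) (hκ : 1 ≤ κ)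
    {s : ℝ≥0} (h : ℝ≥0) (hK : Measurable[ℱ s] K)
    (hV : Integrable (fun ω => κ ^ (K ω).natAbs) P) (M j : ℕ) :
    Integrable (fun ω => κ ^ (K ω + gridCurrent (fun r => η r ω) s h M j).natAbs) P ∧
      ∫ ω, κ ^ (K ω + gridCurrent (fun r => η r ω) s h M j).natAbs ∂P ≤
        (1 + growthRate p q κ * (h / M)) ^ j * ∫ ω, κ ^ (K ω).natAbs ∂P := by
  induction j with
  | zero => simpa [gridCurrent] using hV
  | succ j ih =>
    have hKj := hη.measurable_add_gridCurrent hK h M j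
    have hstep := hη.abs_integral_step_le hp hq hκ (isTempered_weight κ hκ) _ (h / M) hKj ih.1
    simp only [gridCurrent_succ, ← add_assoc]
    refine ⟨integrable_weight_add hκ (hKj.mono (ℱ.le _) le_rfl)
      ((hη.measurable_bondJump le_self_add le_rfl).mono (ℱ.le _) le_rfl)
      (fun _ => abs_bondJump_le _ _) ih.1, ?_⟩
    have h1 := (abs_le.1 hstep).2
    have h2 : 0 ≤ 1 + growthRate p q κ * ((h : ℝ) / M) := by
      have := growthRate_nonneg hp hq hκ
      positivity
    have h3 := mul_le_mul_of_nonneg_left ih.2 h2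
    rw [← mul_assoc, ← pow_succ'] at h3
    refine le_trans ?_ h3
    rw [one_mul] at h1
    push_cast at h1
    rw [add_mul, one_mul, growthRate]
    linarith

lemma IsASEP.integral_weight_gridCurrent_le (hη : IsASEP p q ℱ P η) (hp : 0 ≤ p) (hq : 0 ≤ q)
    (hκ : 1 ≤ κ) {s : ℝ≥0} (h : ℝ≥0) (hK : Measurable[ℱ s] K)
    (hV : Integrable (fun ω => κ ^ (K ω).natAbs) P) {M j : ℕ} (hM : M ≠ 0) (hj : j ≤ M) :
    ∫ ω, κ ^ (K ω + gridCurrent (fun r => η r ω) s h M j).natAbs ∂P ≤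
      Real.exp (growthRate p q κ * h) * ∫ ω, κ ^ (K ω).natAbs ∂P := by
  refine (hη.weight_gridCurrent hp hq hκ h hK hV M j).2.trans ?_
  have hg := growthRate_nonneg (p := p) (q := q) hp hq hκ
  gcongr
  have hM' : (0 : ℝ) < M := by positivity
  calc (1 + growthRate p q κ * (h / M)) ^ j ≤ Real.exp (growthRate p q κ * (h / M)) ^ j := by
        gcongr
        rw [add_comm]; exact Real.add_one_le_exp _
    _ = Real.exp (j * (growthRate p q κ * (h / M))) := (Real.exp_nat_mul _ _).symm
    _ ≤ Real.exp (growthRate p q κ * h) := by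
        rw [Real.exp_le_exp]
        calc (j : ℝ) * (growthRate p q κ * (h / M)) ≤ M * (growthRate p q κ * (h / M)) := by gcongr
          _ = growthRate p q κ * h := by field_simp

/-- A bound for the second time derivative of the mean of a tempered function. -/
noncomputable def secondOrderBound (p q κ B : ℝ) (W : Finset ℤ) : ℝ :=
  generatorBound p q (enlarge (enlarge W)) * (generatorBound p q W * (B * κ) * κ)

lemma IsTempered.secondOrderBound_nonneg (hp : 0 ≤ p) (hq : 0 ≤ q) (hκ : 1 ≤ κ)
    (hF : IsTempered W κ B F) : 0 ≤ secondOrderBound p q κ B W := by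
  have hW0 := generatorBound_nonneg hp hq W
  have hW1 := generatorBound_nonneg hp hq (enlarge (enlarge W))
  have hB := hF.bound_nonneg
  unfold secondOrderBound
  positivity

/-- The sum of the step estimates over a grid: the error is `O(h ^ 2)` uniformly in the number
`M` of steps. -/
lemma IsASEP.abs_integral_grid_le (hη : IsASEP p q ℱ P η) (hp : 0 ≤ p) (hq : 0 ≤ q)
    (hκ : 1 ≤ κ) (hF : IsTempered W κ B F) {s : ℝ≥0} (h : ℝ≥0) (hK : Measurable[ℱ s] K)
    (hV : Integrable (fun ω => κ ^ (K ω).natAbs) P) {M : ℕ} (hM : M ≠ 0) :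
    |∫ ω, F (K ω + gridCurrent (fun r => η r ω) s h M M) (η (s + h) ω) ∂P
        - ∫ ω, F (K ω) (η s ω) ∂P - h * ∫ ω, augmentedGenerator p q F (K ω) (η s ω) ∂P| ≤
      secondOrderBound p q κ B W *
        (Real.exp (growthRate p q κ * h) * ∫ ω, κ ^ (K ω).natAbs ∂P) * h ^ 2 := by
  set E := Real.exp (growthRate p q κ * h) * ∫ ω, κ ^ (K ω).natAbs ∂P
  have hW0 := generatorBound_nonneg hp hq W
  have hW1 := generatorBound_nonneg hp hq (enlarge (enlarge W))
  have hB := hF.bound_nonneg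
  have hκ0 : 0 ≤ κ := by linarith
  have hM' : (M : ℝ) ≠ 0 := by exact_mod_cast hM
  have hE : ∀ j < M, ∫ ω, κ ^ (K ω + gridCurrent (fun r => η r ω) s h M j).natAbs ∂P ≤ E :=
    fun j hj => hη.integral_weight_gridCurrent_le hp hq hκ h hK hV hM hj.le
  have key := abs_sub_sub_le_of_steps (M := M) (δ := ((h / M : ℝ≥0) : ℝ))
    (D := secondOrderBound p q κ B W * E)
    (a := fun j => ∫ ω, F (K ω + gridCurrent (fun r => η r ω) s h M j)
      (η (gridTime s h M j) ω) ∂P)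
    (b := fun j => ∫ ω, augmentedGenerator p q F (K ω + gridCurrent (fun r => η r ω) s h M j)
      (η (gridTime s h M j) ω) ∂P) (by positivity) ?_ ?_
  · have e : (M : ℝ) * ((h / M : ℝ≥0) : ℝ) = h := by push_cast; field_simp
    rw [e, gridTime_self s h hM, gridTime_zero] at key
    simpa [gridCurrent] using key
  · intro j hj
    have hstep := hη.abs_integral_step_sub_generator_le hp hq hκ hF _ (h / M)
      (hη.measurable_add_gridCurrent hK h M j) (hη.weight_gridCurrent hp hq hκ h hK hV M j).1
    simp only [gridCurrent_succ, gridTime_succ, ← add_assoc]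
    refine hstep.trans ?_
    rw [mul_right_comm, secondOrderBound]
    refine mul_le_mul_of_nonneg_right (mul_le_mul (mul_le_mul_of_nonneg_left ?_ hW1) (hE j hj)
      (integral_nonneg fun _ => by positivity) (by positivity)) (by positivity)
    exact le_mul_of_one_le_right (by positivity) hκ
  · intro j hj
    have hstep := hη.abs_integral_step_le hp hq hκ (hF.augmentedGenerator hp hq hκ) _ (h / M)
      (hη.measurable_add_gridCurrent hK h M j) (hη.weight_gridCurrent hp hq hκ h hK hV M j).1
    simp only [gridCurrent_succ, gridTime_succ, ← add_assoc]
    refine hstep.trans ?_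
    rw [mul_right_comm, secondOrderBound]
    gcongr
    exact hE j hj

/-! ### Refining the grid -/

/-- Fatou's lemma along finer and finer grids bounds the exponential moments of the current. -/
lemma IsASEP.weight_current (hη : IsASEP p q ℱ P η) (hp : 0 ≤ p) (hq : 0 ≤ q) (hκ : 1 ≤ κ)
    (t : ℝ≥0) :
    Integrable (fun ω => κ ^ (current (fun r => η r ω) 0 t).natAbs) P ∧
      ∫ ω, κ ^ (current (fun r => η r ω) 0 t).natAbs ∂P ≤ Real.exp (growthRate p q κ * t) := by
  have hpos : ∀ m : ℤ, 0 ≤ κ ^ m.natAbs := fun m => by positivity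
  have hw : Measurable fun m : ℤ => κ ^ m.natAbs := measurable_of_countable _
  have hm : Measurable fun ω => κ ^ (current (fun r => η r ω) 0 t).natAbs :=
    hw.comp ((hη.measurable_current t).mono (ℱ.le t) le_rfl)
  have hV0 : Integrable (fun _ : Ω => κ ^ (0 : ℤ).natAbs) P := integrable_const _
  have hK0 : Measurable[ℱ 0] fun _ : Ω => (0 : ℤ) := measurable_const
  let G : ℕ → Ω → ENNReal := fun M ω =>
    ENNReal.ofReal (κ ^ (gridCurrent (fun r => η r ω) 0 t (M + 1) (M + 1)).natAbs)
  have hGm : ∀ M, Measurable (G M) := fun M =>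
    ENNReal.measurable_ofReal.comp (hw.comp
      ((hη.measurable_gridCurrent 0 t (M + 1) (M + 1)).mono (ℱ.le _) le_rfl))
  have hG : ∀ M, ∫⁻ ω, G M ω ∂P ≤ ENNReal.ofReal (Real.exp (growthRate p q κ * t)) := by
    intro M
    have h1 := (hη.weight_gridCurrent hp hq hκ t hK0 hV0 (M + 1) (M + 1)).1
    have h2 := hη.integral_weight_gridCurrent_le hp hq hκ t hK0 hV0 (Nat.succ_ne_zero M) le_rfl
    simp only [zero_add, Int.natAbs_zero, pow_zero, integral_const, probReal_univ, smul_eq_mul,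
      mul_one] at h1 h2
    rw [← ofReal_integral_eq_lintegral_ofReal h1 (Eventually.of_forall fun _ => hpos _)]
    exact ENNReal.ofReal_le_ofReal h2
  have hlim : ∀ ω, liminf (fun M => G M ω) atTop =
      ENNReal.ofReal (κ ^ (current (fun r => η r ω) 0 t).natAbs) := by
    intro ω
    have h1 := (tendsto_add_atTop_nat 1).eventually
      ((hη.isCadlagPath ω).eventually_gridCurrent 0 t)
    simp only [current_zero, zero_add] at h1
    exact (tendsto_nhds_of_eventually_eq (h1.mono fun M hM => by simp only [G, hM])).liminf_eq
  have hle : ∫⁻ ω, ENNReal.ofReal (κ ^ (current (fun r => η r ω) 0 t).natAbs) ∂P ≤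
      ENNReal.ofReal (Real.exp (growthRate p q κ * t)) := by
    simp only [← hlim]
    refine (lintegral_liminf_le hGm).trans ?_
    exact liminf_le_of_frequently_le' (Frequently.of_forall hG)
  have hi : Integrable (fun ω => κ ^ (current (fun r => η r ω) 0 t).natAbs) P := by
    refine ⟨hm.aestronglyMeasurable, ?_⟩
    rw [hasFiniteIntegral_iff_ofReal (Eventually.of_forall fun _ => hpos _)]
    exact hle.trans_lt ENNReal.ofReal_lt_top
  refine ⟨hi, ?_⟩
  rw [← ENNReal.ofReal_le_ofReal_iff (Real.exp_pos _).le,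
    ofReal_integral_eq_lintegral_ofReal hi (Eventually.of_forall fun _ => hpos _)]
  exact hle

/-- The function `F`, set to zero where the current exceeds `R` in absolute value. It is bounded,
which allows the grid to be refined by dominated convergence, and it is tempered with the same
constants as `F`, so that the error bounds do not depend on `R`. -/
noncomputable def truncate (R : ℕ) (F : ℤ → Config → ℝ) (m : ℤ) (ξ : Config) : ℝ :=
  if m.natAbs ≤ R then F m ξ else 0

lemma IsTempered.truncate (hF : IsTempered W κ B F) (hκ : 1 ≤ κ) (R : ℕ) :
    IsTempered W κ B (truncate R F) where
  zero_mem := hF.zero_mem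
  one_mem := hF.one_mem
  dependsOn m := by
    intro ξ ζ h
    simp only [ASEP.truncate, hF.dependsOn m h]
  bound m ξ := by
    unfold ASEP.truncate
    split_ifs
    · exact hF.bound m ξ
    · rw [abs_zero]
      have := hF.bound_nonneg
      positivity

lemma IsTempered.abs_truncate_le (hF : IsTempered W κ B F) (hκ : 1 ≤ κ) (R : ℕ) (m : ℤ)
    (ξ : Config) : |ASEP.truncate R F m ξ| ≤ B * κ ^ R := by
  have := hF.bound_nonneg
  unfold ASEP.truncate
  split_ifs with h
  · exact (hF.bound m ξ).trans (by gcongr)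
  · rw [abs_zero]; positivity

lemma tendsto_truncate (F : ℤ → Config → ℝ) (m : ℤ) (ξ : Config) :
    Tendsto (fun R => truncate R F m ξ) atTop (𝓝 (F m ξ)) :=
  tendsto_nhds_of_eventually_eq <| by
    filter_upwards [eventually_ge_atTop m.natAbs] with R hR
    rw [truncate, if_pos hR]

lemma tendsto_augmentedGenerator_truncate (p q : ℝ) (F : ℤ → Config → ℝ) (m : ℤ) (ξ : Config) :
    Tendsto (fun R => augmentedGenerator p q (truncate R F) m ξ) atTop
      (𝓝 (augmentedGenerator p q F m ξ)) :=
  tendsto_nhds_of_eventually_eq <| by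
    filter_upwards [eventually_ge_atTop (m.natAbs + 1)] with R hR
    have h : ∀ ζ, truncate R F (m + bondJump (bond 0 ξ) (bond 0 ζ)) ζ =
        F (m + bondJump (bond 0 ξ) (bond 0 ζ)) ζ := by
      intro ζ
      rw [truncate, if_pos]
      have h1 := abs_le.1 (abs_bondJump_le (bond 0 ξ) (bond 0 ζ))
      omega
    simp only [augmentedGenerator, h]

/-- The mean at time `t` of a function of the current and the configuration. -/
noncomputable def mean (P : Measure Ω) (η : ℝ≥0 → Ω → Config) (F : ℤ → Config → ℝ) (t : ℝ≥0) :
    ℝ := ∫ ω, F (current (fun r => η r ω) 0 t) (η t ω) ∂P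

lemma IsASEP.integrable_current (hη : IsASEP p q ℱ P η) (hp : 0 ≤ p) (hq : 0 ≤ q) (hκ : 1 ≤ κ)
    (hF : IsTempered W κ B F) (t : ℝ≥0) :
    Integrable (fun ω => F (current (fun r => η r ω) 0 t) (η t ω)) P :=
  hη.integrable_tempered hF ((hη.measurable_current t).mono (ℱ.le t) le_rfl)
    (hη.weight_current hp hq hκ t).1 t

lemma IsASEP.abs_mean_truncate_le (hη : IsASEP p q ℱ P η) (hp : 0 ≤ p) (hq : 0 ≤ q)
    (hκ : 1 ≤ κ) (hF : IsTempered W κ B F) (s h : ℝ≥0) (R : ℕ) :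
    |mean P η (truncate R F) (s + h) - mean P η (truncate R F) s
        - h * mean P η (augmentedGenerator p q (truncate R F)) s| ≤
      secondOrderBound p q κ B W *
        (Real.exp (growthRate p q κ * h) * Real.exp (growthRate p q κ * s)) * h ^ 2 := by
  have hT := hF.truncate hκ R
  have hK := hη.measurable_current s
  obtain ⟨hV, hVle⟩ := hη.weight_current hp hq hκ s
  have hlim : Tendsto (fun M : ℕ => ∫ ω, truncate R F (current (fun r => η r ω) 0 s
      + gridCurrent (fun r => η r ω) s h M M) (η (s + h) ω) ∂P) atTop
      (𝓝 (mean P η (truncate R F) (s + h))) := by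
    refine tendsto_integral_of_dominated_convergence (fun _ => B * κ ^ R) (fun M => ?_)
      (integrable_const _) (fun M => Eventually.of_forall fun _ => hF.abs_truncate_le hκ R _ _)
      (Eventually.of_forall fun ω => ?_)
    · exact (hη.measurable_tempered hT ((hη.measurable_add_gridCurrent hK h M M).mono (ℱ.le _)
        le_rfl) _).aestronglyMeasurable
    · refine tendsto_nhds_of_eventually_eq ?_
      filter_upwards [(hη.isCadlagPath ω).eventually_gridCurrent s h] with M hM
      rw [hM]
  refine le_of_tendsto ((hlim.sub_const _).sub_const _).abs ?_
  filter_upwards [eventually_ne_atTop 0] with M hM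
  refine (hη.abs_integral_grid_le hp hq hκ hT h hK hV hM).trans ?_
  have := hF.secondOrderBound_nonneg hp hq hκ
  gcongr

lemma IsASEP.tendsto_mean (hη : IsASEP p q ℱ P η) (hp : 0 ≤ p) (hq : 0 ≤ q) (hκ : 1 ≤ κ)
    {G : ℕ → ℤ → Config → ℝ} (hG : ∀ R, IsTempered W κ B (G R))
    (hlim : ∀ m ξ, Tendsto (fun R => G R m ξ) atTop (𝓝 (F m ξ))) (t : ℝ≥0) :
    Tendsto (fun R => mean P η (G R) t) atTop (𝓝 (mean P η F t)) :=
  tendsto_integral_of_dominated_convergence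
    (fun ω => B * κ ^ (current (fun r => η r ω) 0 t).natAbs)
    (fun R => (hη.integrable_current hp hq hκ (hG R) t).aestronglyMeasurable)
    ((hη.weight_current hp hq hκ t).1.const_mul B)
    (fun R => Eventually.of_forall fun _ => (hG R).bound _ _)
    (Eventually.of_forall fun _ => hlim _ _)

/-- The second-order Taylor estimate for the mean of a function of current and configuration. -/
lemma IsASEP.abs_mean_le (hη : IsASEP p q ℱ P η) (hp : 0 ≤ p) (hq : 0 ≤ q)
    (hκ : 1 ≤ κ) (hF : IsTempered W κ B F) (s h : ℝ≥0) :
    |mean P η F (s + h) - mean P η F s - h * mean P η (augmentedGenerator p q F) s| ≤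
      secondOrderBound p q κ B W * Real.exp (growthRate p q κ * (s + h)) * h ^ 2 := by
  have h1 := fun t => hη.tendsto_mean hp hq hκ (hF.truncate hκ) (tendsto_truncate F) t
  have h2 := hη.tendsto_mean hp hq hκ (fun R => (hF.truncate hκ R).augmentedGenerator hp hq hκ)
    (tendsto_augmentedGenerator_truncate p q F) s
  refine le_of_tendsto (((h1 _).sub (h1 _)).sub (h2.const_mul (h : ℝ))).abs
    (Eventually.of_forall fun R => ?_)
  refine (hη.abs_mean_truncate_le hp hq hκ hF s h R).trans (le_of_eq ?_)
  rw [← Real.exp_add]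
  congr 3
  ring

lemma IsASEP.abs_mean_le_exp (hη : IsASEP p q ℱ P η) (hp : 0 ≤ p) (hq : 0 ≤ q)
    (hκ : 1 ≤ κ) (hF : IsTempered W κ B F) (t : ℝ≥0) :
    |mean P η F t| ≤ B * Real.exp (growthRate p q κ * t) := by
  obtain ⟨hV, hVle⟩ := hη.weight_current hp hq hκ t
  refine (norm_integral_le_of_norm_le (f := fun ω => F (current (fun r => η r ω) 0 t) (η t ω))
    (hV.const_mul B) (Eventually.of_forall fun _ => hF.bound _ _)).trans ?_
  rw [integral_const_mul]
  exact mul_le_mul_of_nonneg_left hVle hF.bound_nonneg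

end Grid

/-! ### Differentiating the mean -/

/-- A function with a locally uniform first-order expansion to the right, whose coefficient is
locally Lipschitz, is differentiable from both sides. -/
lemma hasDerivWithinAt_Ici_of_abs_le {f g : ℝ≥0 → ℝ} {D : ℝ → ℝ} (hD : Monotone D)
    (hf : ∀ s h : ℝ≥0, |f (s + h) - f s - h * g s| ≤ D (s + h) * h ^ 2)
    (hg : ∀ s h : ℝ≥0, |g (s + h) - g s| ≤ D (s + h) * h) (t : ℝ≥0) :
    HasDerivWithinAt (fun s : ℝ => f s.toNNReal) (g t) (Ici 0) t := by
  have key : ∀ s : ℝ≥0, (s : ℝ) ≤ t + 1 →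
      |f s - f t - ((s : ℝ) - t) * g t| ≤ 2 * D (t + 1) * ((s : ℝ) - t) ^ 2 := by
    intro s hs1
    have hD0 : 0 ≤ D (t + 1) := by
      have := (abs_nonneg _).trans (hg t 1)
      simpa using this
    rcases le_total t s with hts | hst
    · obtain ⟨h, rfl⟩ := exists_add_of_le hts
      push_cast at hs1 ⊢
      rw [add_sub_cancel_left]
      refine (hf t h).trans ?_
      have := mul_le_mul_of_nonneg_right (hD hs1) (sq_nonneg (h : ℝ))
      have := mul_nonneg hD0 (sq_nonneg (h : ℝ))
      linarith
    · obtain ⟨h, rfl⟩ := exists_add_of_le hst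
      push_cast at hs1 hD0 ⊢
      -- To the left of `t = s + h`, expand around `s` and move the coefficient from `s` to `t`.
      have e : f s - f (s + h) - ((s : ℝ) - (s + h)) * g (s + h) =
          -(f (s + h) - f s - h * g s) + h * (g (s + h) - g s) := by ring
      have h1 := hf s h
      have h2 := mul_le_mul_of_nonneg_left (hg s h) h.2
      have h3 : D (s + h) ≤ D (s + h + 1) := hD (by linarith)
      have h4 := mul_le_mul_of_nonneg_right h3 (sq_nonneg (h : ℝ))
      rw [e]
      refine (abs_add_le _ _).trans ?_
      rw [abs_neg, abs_mul, NNReal.abs_eq]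
      change (h : ℝ) * _ ≤ (h : ℝ) * _ at h2
      nlinarith
  rw [hasDerivWithinAt_iff_isLittleO]
  have hO : (fun s : ℝ => f s.toNNReal - f (t : ℝ).toNNReal - (s - t) • g t) =O[𝓝[Ici 0] (t : ℝ)]
      fun s => (s - t) ^ 2 := by
    refine Asymptotics.IsBigO.of_bound (2 * D (t + 1)) ?_
    have hlt : ∀ᶠ s : ℝ in 𝓝[Ici 0] (t : ℝ), s < t + 1 :=
      mem_nhdsWithin_of_mem_nhds (Iio_mem_nhds (by linarith))
    filter_upwards [hlt, self_mem_nhdsWithin] with s hs hs0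
    have := key s.toNNReal (by rw [Real.coe_toNNReal s hs0]; exact hs.le)
    rw [Real.coe_toNNReal s hs0] at this
    rw [Real.toNNReal_coe, smul_eq_mul, Real.norm_eq_abs, norm_pow, Real.norm_eq_abs, sq_abs]
    exact this
  refine hO.trans_isLittleO ?_
  have h2 : (fun s : ℝ => (s - t) ^ 2) =o[𝓝 (t : ℝ)] fun s => s - t := by
    have h3 : Tendsto (fun s : ℝ => s - t) (𝓝 (t : ℝ)) (𝓝 0) := by
      have : Continuous fun s : ℝ => s - t := by fun_prop
      simpa using this.tendsto (t : ℝ)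
    have := (Asymptotics.isLittleO_pow_id (𝕜 := ℝ) (n := 2) (by norm_num)).comp_tendsto h3
    simpa [Function.comp_def] using this
  exact h2.mono nhdsWithin_le_nhds

/-- Dynkin's formula in differential form for the pair of current and configuration. -/
lemma IsASEP.hasDerivWithinAt_mean {Ω : Type*} {mΩ : MeasurableSpace Ω} {p q : ℝ}
    {ℱ : Filtration ℝ≥0 mΩ} {P : Measure Ω} [IsProbabilityMeasure P] {η : ℝ≥0 → Ω → Config}
    {W : Finset ℤ} {κ B : ℝ} {F : ℤ → Config → ℝ}
    (hη : IsASEP p q ℱ P η) (hp : 0 ≤ p) (hq : 0 ≤ q)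
    (hκ : 1 ≤ κ) (hF : IsTempered W κ B F) (t : ℝ≥0) :
    HasDerivWithinAt (fun s : ℝ => mean P η F s.toNNReal)
      (mean P η (augmentedGenerator p q F) t) (Ici 0) t := by
  have hF1 := hF.augmentedGenerator hp hq hκ
  have hF2 := hF1.augmentedGenerator hp hq hκ
  have hr := growthRate_nonneg (p := p) (q := q) hp hq hκ
  have hs0 := hF.secondOrderBound_nonneg hp hq hκ
  have hs1 := hF1.secondOrderBound_nonneg hp hq hκ
  have hB2 := hF2.bound_nonneg
  set S0 := secondOrderBound p q κ B W
  set S1 := secondOrderBound p q κ (generatorBound p q W * (B * κ)) (enlarge (enlarge W))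
  set B2 := generatorBound p q (enlarge (enlarge W)) * (generatorBound p q W * (B * κ) * κ)
  let D : ℝ → ℝ := fun x => (S0 + B2 + S1 * max x 0) * Real.exp (growthRate p q κ * x)
  have hDmono : Monotone D := by
    intro x y hxy
    have : max x 0 ≤ max y 0 := max_le_max_right 0 hxy
    have h0 : 0 ≤ max x 0 := le_max_right _ _
    simp only [D]
    gcongr
  refine hasDerivWithinAt_Ici_of_abs_le hDmono (fun s h => ?_) (fun s h => ?_) t
  · refine (hη.abs_mean_le hp hq hκ hF s h).trans ?_
    simp only [D]
    gcongr
    have : 0 ≤ max ((s : ℝ) + h) 0 := le_max_right _ _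
    have := mul_nonneg hs1 this
    linarith
  · -- The Taylor estimate for `LF`, with the mean of `L L F` locally bounded, gives the
    -- Lipschitz bound for the mean of `LF`.
    have h1 := hη.abs_mean_le hp hq hκ hF1 s h
    have h2 := hη.abs_mean_le_exp hp hq hκ hF2 s
    have h3 : Real.exp (growthRate p q κ * s) ≤ Real.exp (growthRate p q κ * (s + h)) := by
      gcongr; exact le_add_of_nonneg_right h.2
    have h4 : |(h : ℝ) * mean P η (ASEP.augmentedGenerator p q (ASEP.augmentedGenerator p q F)) s|
        ≤ B2 * Real.exp (growthRate p q κ * (s + h)) * h := by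
      rw [abs_mul, NNReal.abs_eq, mul_comm]
      exact mul_le_mul_of_nonneg_right (h2.trans (mul_le_mul_of_nonneg_left h3 hB2)) h.2
    have h5 : S1 * Real.exp (growthRate p q κ * (s + h)) * h ^ 2 ≤
        S1 * max ((s : ℝ) + h) 0 * Real.exp (growthRate p q κ * (s + h)) * h := by
      have : (h : ℝ) ≤ max ((s : ℝ) + h) 0 :=
        le_max_of_le_left (le_add_of_nonneg_left s.2)
      calc S1 * Real.exp (growthRate p q κ * (s + h)) * h ^ 2 =
          S1 * h * Real.exp (growthRate p q κ * (s + h)) * h := by ring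
        _ ≤ _ := by gcongr
    have h6 : 0 ≤ S0 * Real.exp (growthRate p q κ * (s + h)) * h := by positivity
    have h7 := abs_add_le (mean P η (ASEP.augmentedGenerator p q F) (s + h)
      - mean P η (ASEP.augmentedGenerator p q F) s
      - h * mean P η (ASEP.augmentedGenerator p q (ASEP.augmentedGenerator p q F)) s)
      (h * mean P η (ASEP.augmentedGenerator p q (ASEP.augmentedGenerator p q F)) s)
    rw [sub_add_cancel] at h7
    simp only [D]
    linarith

/-! ### The height function -/

/-- The height at `y` of a configuration `ξ`, normalised to be `m` at `0`. The height function of a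
trajectory at time `t` is the case where `m` is the current through the bond `(0, 1)`. -/
noncomputable def localHeight (m : ℤ) (ξ : Config) (y : ℤ) : ℤ :=
  m + ∑ z ∈ Finset.Icc 1 y, occ ξ z - ∑ z ∈ Finset.Icc (y + 1) 0, occ ξ z

lemma localHeight_zero (m : ℤ) (ξ : Config) : localHeight m ξ 0 = m := by
  simp [localHeight]

lemma localHeight_add_one (m : ℤ) (ξ : Config) (y : ℤ) :
    localHeight m ξ (y + 1) = localHeight m ξ y + occ ξ (y + 1) := by
  unfold localHeight
  rcases le_or_gt 0 y with hy | hy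
  · have h1 : Finset.Icc 1 (y + 1) = insert (y + 1) (Finset.Icc 1 y) := by
      ext z; simp only [Finset.mem_Icc, Finset.mem_insert]; omega
    have h2 : Finset.Icc (y + 1 + 1) 0 = ∅ := Finset.Icc_eq_empty (by omega)
    have h3 : Finset.Icc (y + 1) 0 = ∅ := Finset.Icc_eq_empty (by omega)
    rw [h1, h2, h3, Finset.sum_insert (by simp)]
    ring
  · have h1 : Finset.Icc (y + 1) 0 = insert (y + 1) (Finset.Icc (y + 1 + 1) 0) := by
      ext z; simp only [Finset.mem_Icc, Finset.mem_insert]; omega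
    have h2 : Finset.Icc 1 (y + 1) = ∅ := Finset.Icc_eq_empty (by omega)
    have h3 : Finset.Icc 1 y = ∅ := Finset.Icc_eq_empty (by omega)
    rw [h1, h2, h3, Finset.sum_insert (by simp)]
    ring

lemma localHeight_sub_one (m : ℤ) (ξ : Config) (y : ℤ) :
    localHeight m ξ (y - 1) = localHeight m ξ y - occ ξ y := by
  have := localHeight_add_one m ξ (y - 1)
  rw [sub_add_cancel] at this
  rw [this, add_sub_cancel_right]

lemma abs_localHeight_sub_le (m : ℤ) (ξ : Config) (y : ℤ) : |localHeight m ξ y - m| ≤ |y| := by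
  have ho : ∀ z, 0 ≤ occ ξ z ∧ occ ξ z ≤ 1 := fun z => by unfold occ; split_ifs <;> simp
  induction y using Int.induction_on with
  | zero => simp [localHeight_zero]
  | succ i ih =>
    rw [localHeight_add_one]
    have := ho (i + 1)
    rw [abs_of_nonneg (by positivity : (0 : ℤ) ≤ i)] at ih
    rw [abs_of_nonneg (by positivity : (0 : ℤ) ≤ (i : ℤ) + 1)]
    rw [abs_le] at ih ⊢
    omega
  | pred i ih =>
    rw [localHeight_sub_one]
    have := ho (-i)
    rw [abs_neg, abs_of_nonneg (by positivity : (0 : ℤ) ≤ i)] at ih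
    rw [abs_of_nonpos (by omega : -(i : ℤ) - 1 ≤ 0)]
    rw [abs_le] at ih ⊢
    omega

/-- The change of the height at `x` when the contents of `x` and `x + 1` are exchanged. -/
def heightJump (ξ : Config) (x : ℤ) : ℤ := occ ξ (x + 1) - occ ξ x

lemma occ_exchange (ξ : Config) (x y : ℤ) :
    occ (exchange ξ x) y = occ ξ y + (if y = x then heightJump ξ x else 0)
      - (if y = x + 1 then heightJump ξ x else 0) := by
  unfold heightJump
  rcases eq_or_ne y x with rfl | h1
  · simp [occ, exchange, Equiv.swap_apply_left]
  · rcases eq_or_ne y (x + 1) with rfl | h2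
    · simp [occ, exchange, Equiv.swap_apply_right]
    · simp [occ, exchange, Equiv.swap_apply_of_ne_of_ne h1 h2, h1, h2]

lemma bondJump_exchange (ξ : Config) (x : ℤ) :
    bondJump (bond 0 ξ) (bond 0 (exchange ξ x)) = if x = 0 then heightJump ξ x else 0 := by
  have hl : ∀ a b c : Bool, bondJump (a, b) (a, c) = 0 := by decide
  have hr : ∀ a b c : Bool, bondJump (a, c) (b, c) = 0 := by decide
  unfold bond
  split_ifs with hx
  · subst hx
    unfold heightJump occ exchange
    rw [Equiv.swap_apply_left, Equiv.swap_apply_right]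
    cases ξ 0 <;> cases ξ (0 + 1) <;> simp [bondJump]
  · by_cases h1 : x = -1
    · have : exchange ξ x (0 + 1) = ξ (0 + 1) := by
        rw [exchange, Equiv.swap_apply_of_ne_of_ne (by omega) (by omega)]
      rw [this, hr]
    · have : exchange ξ x 0 = ξ 0 := by
        rw [exchange, Equiv.swap_apply_of_ne_of_ne (by omega) (by omega)]
      rw [this, hl]

/-- A jump across the bond `(x, x + 1)` changes the height function at `x` only. -/
lemma localHeight_exchange (m : ℤ) (ξ : Config) (x y : ℤ) :
    localHeight (m + bondJump (bond 0 ξ) (bond 0 (exchange ξ x))) (exchange ξ x) y =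
      localHeight m ξ y + if y = x then heightJump ξ x else 0 := by
  rw [bondJump_exchange]
  induction y using Int.induction_on with
  | zero => simp only [localHeight_zero, eq_comm]
  | succ i ih =>
    rw [localHeight_add_one, localHeight_add_one, ih, occ_exchange]
    simp only [add_left_inj]
    ring
  | pred i ih =>
    rw [localHeight_sub_one, localHeight_sub_one, ih, occ_exchange]
    have : (-(i : ℤ) - 1 = x) ↔ (-(i : ℤ) = x + 1) := by omega
    simp only [this]
    ring

/-! ### Products of powers of the height -/

/-- The product `∏ᵢ τ ^ N(xᵢ)` as a function of the height `m` at `0` and the configuration. -/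
noncomputable def tauFunction (τ : ℝ) {n : ℕ} (x : Fin n → ℤ) (m : ℤ) (ξ : Config) : ℝ :=
  ∏ i, τ ^ localHeight m ξ (x i)

section TauFunction

variable {n : ℕ}

lemma localHeight_congr {ξ ζ : Config} {y : ℤ}
    (h : ∀ z ∈ Finset.Icc 1 y ∪ Finset.Icc (y + 1) 0, ξ z = ζ z) (m : ℤ) :
    localHeight m ξ y = localHeight m ζ y := by
  unfold localHeight
  congr 1
  · congr 1
    refine Finset.sum_congr rfl fun z hz => ?_
    rw [occ, occ, h z (Finset.mem_union_left _ hz)]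
  · refine Finset.sum_congr rfl fun z hz => ?_
    rw [occ, occ, h z (Finset.mem_union_right _ hz)]

lemma zpow_le_inv_pow_natAbs {τ : ℝ} (h0 : 0 < τ) (h1 : τ ≤ 1) (k : ℤ) :
    τ ^ k ≤ τ⁻¹ ^ k.natAbs := by
  have h2 : 1 ≤ τ⁻¹ := (one_le_inv₀ h0).2 h1
  rw [← zpow_natCast, inv_zpow', Int.natCast_natAbs]
  exact zpow_le_zpow_right_of_le_one₀ h0 h1 (neg_abs_le k)

/-- The sites on which `tauFunction τ x` depends, together with `0` and `1`. -/
noncomputable def heightWindow (x : Fin n → ℤ) : Finset ℤ :=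
  {0, 1} ∪ Finset.univ.biUnion fun i => Finset.Icc 1 (x i) ∪ Finset.Icc (x i + 1) 0

lemma isTempered_tauFunction {τ : ℝ} (h0 : 0 < τ) (h1 : τ ≤ 1) (x : Fin n → ℤ) :
    IsTempered (heightWindow x) (τ⁻¹ ^ n) (∏ i, τ⁻¹ ^ (x i).natAbs) (tauFunction τ x) where
  zero_mem := by simp [heightWindow]
  one_mem := by simp [heightWindow]
  dependsOn m := by
    intro ξ ζ h
    refine Finset.prod_congr rfl fun i _ => ?_
    rw [localHeight_congr fun z hz => h z ?_]
    exact Finset.mem_union_right _ (Finset.mem_biUnion.2 ⟨i, Finset.mem_univ i, hz⟩)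
  bound m ξ := by
    have h2 : 1 ≤ τ⁻¹ := (one_le_inv₀ h0).2 h1
    unfold tauFunction
    rw [abs_of_nonneg (Finset.prod_nonneg fun i _ => by positivity)]
    calc ∏ i, τ ^ localHeight m ξ (x i) ≤ ∏ i, (τ⁻¹ ^ (x i).natAbs * τ⁻¹ ^ m.natAbs) := by
          refine Finset.prod_le_prod (fun i _ => by positivity) fun i _ => ?_
          rw [← pow_add]
          refine (zpow_le_inv_pow_natAbs h0 h1 _).trans (pow_le_pow_right₀ h2 ?_)
          have := abs_localHeight_sub_le m ξ (x i)
          rw [Int.abs_eq_natAbs, Int.abs_eq_natAbs] at this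
          omega
      _ = _ := by
          rw [Finset.prod_mul_distrib, Finset.prod_const, Finset.card_univ, Fintype.card_fin,
            pow_right_comm]

lemma prod_zpow_ite {τ : ℝ} (i : Fin n) (k : ℤ) (c : Fin n → Prop) [DecidablePred c]
    (hc : ∀ j, c j ↔ j = i) : ∏ j, τ ^ (if c j then k else 0) = τ ^ k := by
  rw [Finset.prod_eq_single i (fun j _ hj => by rw [if_neg (mt (hc j).1 hj), zpow_zero])
    (fun h => absurd (Finset.mem_univ i) h), if_pos ((hc i).2 rfl)]

lemma tauFunction_exchange {τ : ℝ} (h0 : τ ≠ 0) (x : Fin n → ℤ) (m : ℤ) (ξ : Config) (y : ℤ) :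
    tauFunction τ x (m + bondJump (bond 0 ξ) (bond 0 (exchange ξ y))) (exchange ξ y) =
      tauFunction τ x m ξ * ∏ i, τ ^ (if x i = y then heightJump ξ y else 0) := by
  unfold tauFunction
  simp only [localHeight_exchange, zpow_add₀ h0, Finset.prod_mul_distrib]

/-- The choice `τ = p / q` makes the action of the generator linear in the occupations. -/
lemma exchangeRate_mul {p q : ℝ} (hp : p ≠ 0) (hq : q ≠ 0) (ξ : Config) (x : ℤ) :
    exchangeRate p q ξ x * ((p / q) ^ heightJump ξ x - 1) =
      (q - p) * ((occ ξ x : ℝ) - occ ξ (x + 1)) := by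
  unfold exchangeRate heightJump occ
  cases ξ x <;> cases ξ (x + 1) <;> simp <;> field_simp

lemma augmentedGenerator_tauFunction {p q : ℝ} (hp : p ≠ 0) (hq : q ≠ 0) {x : Fin n → ℤ}
    (hx : Function.Injective x) (m : ℤ) (ξ : Config) :
    augmentedGenerator p q (tauFunction (p / q) x) m ξ =
      tauFunction (p / q) x m ξ * ((q - p) * ∑ i, ((occ ξ (x i) : ℝ) - occ ξ (x i + 1))) := by
  have h0 : p / q ≠ 0 := div_ne_zero hp hq
  have h1 : augmentedGenerator p q (tauFunction (p / q) x) m ξ =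
      ∑ᶠ y, tauFunction (p / q) x m ξ * (exchangeRate p q ξ y *
        (∏ i, (p / q) ^ (if x i = y then heightJump ξ y else 0) - 1)) := by
    refine finsum_congr fun y => ?_
    beta_reduce
    rw [tauFunction_exchange h0, bondJump_self, add_zero, exchangeRate]
    ring
  rw [h1, finsum_eq_sum_of_support_subset (s := Finset.univ.image x), Finset.sum_image
    (fun i _ j _ hij => hx hij), ← Finset.mul_sum, Finset.mul_sum (a := q - p)]
  · congr 1
    refine Finset.sum_congr rfl fun i _ => ?_
    rw [prod_zpow_ite i _ _ fun j => hx.eq_iff, exchangeRate_mul hp hq]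
  · intro y hy
    by_contra hcon
    have : ∀ i, x i ≠ y := by simpa using hcon
    exact hy (by simp [this])

/-! ### The forward equations -/

lemma support_ite_val_finite (v : Fin n → ℤ) (c : Positions n → ℝ) :
    (Function.support fun y : Positions n => if y.1 = v then c y else 0).Finite := by
  refine Set.Subsingleton.finite fun y hy z hz => Subtype.ext ?_
  have h : ∀ {y : Positions n}, (if y.1 = v then c y else 0) ≠ 0 → y.1 = v := by
    intro y hy
    by_contra hcon
    exact hy (if_neg hcon)
  rw [h hy, h hz]

open Classical in
lemma finsum_ite_val (v : Fin n → ℤ) (c : Positions n → ℝ) :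
    ∑ᶠ y : Positions n, (if y.1 = v then c y else 0) =
      if h : StrictMono v then c ⟨v, h⟩ else 0 := by
  split_ifs with h
  · rw [finsum_eq_single _ ⟨v, h⟩ fun y hy => if_neg fun e => hy (Subtype.ext e), if_pos rfl]
  · have h0 : ∀ y : Positions n, (if y.1 = v then c y else 0) = 0 := fun y =>
      if_neg fun e : y.1 = v => h (e ▸ y.2)
    simp only [h0, finsum_zero]

open Classical in
/-- The right-hand side of the forward equations, grouped by the particle that moves. -/
lemma finsum_rate (p q : ℝ) (u : Positions n → ℝ) (x : Positions n) :
    ∑ᶠ y : Positions n, (rate p q y x * u y - rate p q x y * u x) =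
      ∑ i, ((if h : StrictMono (x.1 - Pi.single i 1) then p * u ⟨_, h⟩ - q * u x else 0)
        + (if h : StrictMono (x.1 + Pi.single i 1) then q * u ⟨_, h⟩ - p * u x else 0)) := by
  have h1 : ∀ y : Positions n, rate p q y x * u y - rate p q x y * u x =
      ∑ i, ((if y.1 = x.1 - Pi.single i 1 then p * u y - q * u x else 0)
        + (if y.1 = x.1 + Pi.single i 1 then q * u y - p * u x else 0)) := by
    intro y
    unfold rate
    rw [Finset.sum_mul, Finset.sum_mul, ← Finset.sum_sub_distrib]
    refine Finset.sum_congr rfl fun i _ => ?_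
    have e1 : x.1 = y.1 + Pi.single i 1 ↔ y.1 = x.1 - Pi.single i 1 :=
      eq_comm.trans eq_sub_iff_add_eq.symm
    have e2 : x.1 = y.1 - Pi.single i 1 ↔ y.1 = x.1 + Pi.single i 1 :=
      eq_sub_iff_add_eq.trans eq_comm
    simp only [e1, e2]
    split_ifs <;> ring
  rw [finsum_congr h1, finsum_sum_comm]
  · refine Finset.sum_congr rfl fun i _ => ?_
    rw [finsum_add_distrib (support_ite_val_finite _ _) (support_ite_val_finite _ _),
      finsum_ite_val, finsum_ite_val]
  · intro i _
    exact ((support_ite_val_finite _ fun y => p * u y - q * u x).union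
      (support_ite_val_finite _ fun y => q * u y - p * u x)).subset
      (Function.support_add _ _)

lemma strictMono_add_single_iff {x : Fin n → ℤ} (hx : StrictMono x) (i : Fin n) :
    StrictMono (x + Pi.single i 1) ↔ ∀ j, x j ≠ x i + 1 := by
  constructor
  · intro h j hj
    have hij : i < j := hx.lt_iff_lt.1 (by omega)
    have := h hij
    simp [Pi.single_eq_of_ne hij.ne', hj] at this
  · intro h a b hab
    have h1 := hx hab
    have h2 := h b
    rcases eq_or_ne a i with rfl | ha
    · simp only [Pi.add_apply, Pi.single_eq_same, Pi.single_eq_of_ne hab.ne']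
      omega
    · rcases eq_or_ne b i with rfl | hb
      · simp only [Pi.add_apply, Pi.single_eq_same, Pi.single_eq_of_ne ha]
        omega
      · simpa [Pi.single_eq_of_ne ha, Pi.single_eq_of_ne hb] using h1

lemma strictMono_sub_single_iff {x : Fin n → ℤ} (hx : StrictMono x) (i : Fin n) :
    StrictMono (x - Pi.single i 1) ↔ ∀ j, x j ≠ x i - 1 := by
  constructor
  · intro h j hj
    have hij : j < i := hx.lt_iff_lt.1 (by omega)
    have := h hij
    simp [Pi.single_eq_of_ne hij.ne, hj] at this
  · intro h a b hab
    have h1 := hx hab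
    have h2 := h a
    rcases eq_or_ne b i with rfl | hb
    · simp only [Pi.sub_apply, Pi.single_eq_same, Pi.single_eq_of_ne hab.ne]
      omega
    · rcases eq_or_ne a i with rfl | ha
      · simp only [Pi.sub_apply, Pi.single_eq_same, Pi.single_eq_of_ne hb]
        omega
      · simpa [Pi.single_eq_of_ne ha, Pi.single_eq_of_ne hb] using h1

lemma tauFunction_sub_single {τ : ℝ} (h0 : τ ≠ 0) (x : Fin n → ℤ) (i : Fin n) (m : ℤ)
    (ξ : Config) :
    tauFunction τ (x - Pi.single i 1) m ξ = tauFunction τ x m ξ * τ ^ (-occ ξ (x i)) := by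
  have h : ∀ j, localHeight m ξ ((x - Pi.single i 1 : Fin n → ℤ) j) =
      localHeight m ξ (x j) + if j = i then -occ ξ (x i) else 0 := by
    intro j
    rcases eq_or_ne j i with rfl | hj
    · simp [localHeight_sub_one, ← sub_eq_add_neg]
    · simp [hj]
  unfold tauFunction
  simp only [h, zpow_add₀ h0, Finset.prod_mul_distrib]
  rw [prod_zpow_ite i _ _ fun j => Iff.rfl]

lemma tauFunction_add_single {τ : ℝ} (h0 : τ ≠ 0) (x : Fin n → ℤ) (i : Fin n) (m : ℤ)
    (ξ : Config) :
    tauFunction τ (x + Pi.single i 1) m ξ = tauFunction τ x m ξ * τ ^ occ ξ (x i + 1) := by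
  have h : ∀ j, localHeight m ξ ((x + Pi.single i 1 : Fin n → ℤ) j) =
      localHeight m ξ (x j) + if j = i then occ ξ (x i + 1) else 0 := by
    intro j
    rcases eq_or_ne j i with rfl | hj
    · simp [localHeight_add_one]
    · simp [hj]
  unfold tauFunction
  simp only [h, zpow_add₀ h0, Finset.prod_mul_distrib]
  rw [prod_zpow_ite i _ _ fun j => Iff.rfl]

open Classical in
lemma ite_forall_ne {x : Fin n → ℤ} (hx : Function.Injective x) (v : ℤ) (c : ℝ) :
    (if ∀ j, x j ≠ v then c else 0) = c - ∑ j, if x j = v then c else 0 := by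
  split_ifs with h
  · simp [h]
  · push Not at h
    obtain ⟨j, rfl⟩ := h
    simp [hx.eq_iff]

open Classical in
/-- Exclusion costs nothing: the terms of the moves blocked by a neighbouring particle cancel in
pairs, between the left and the right particle of each adjacent pair. -/
lemma sum_exclusion {x : Fin n → ℤ} (hx : Function.Injective x) (o : ℤ → ℝ) :
    ∑ i, ((if ∀ j, x j ≠ x i - 1 then o (x i) - 1 else 0)
      + (if ∀ j, x j ≠ x i + 1 then 1 - o (x i + 1) else 0)) =
      ∑ i, (o (x i) - o (x i + 1)) := by
  -- Exchange the roles of `i` and `j`: `x j = x i - 1` says that `i` is the right neighbour of `j`.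
  have h1 : ∑ i, ∑ j, (if x j = x i - 1 then o (x i) - 1 else 0) =
      -∑ i, ∑ j, (if x j = x i + 1 then 1 - o (x i + 1) else 0) := by
    rw [Finset.sum_comm, ← Finset.sum_neg_distrib]
    refine Finset.sum_congr rfl fun i _ => ?_
    rw [← Finset.sum_neg_distrib]
    refine Finset.sum_congr rfl fun j _ => ?_
    by_cases h : x j = x i + 1
    · rw [if_pos (by omega), if_pos h, h]; ring
    · rw [if_neg (by omega), if_neg h, neg_zero]
  simp only [ite_forall_ne hx, Finset.sum_add_distrib, Finset.sum_sub_distrib, h1]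
  ring

open Classical in
/-- Duality: the generator of current and configuration acts on `∏ᵢ τ ^ N(xᵢ)` as the forward
operator of the `n`-particle process acts on it as a function of `x`. -/
lemma augmentedGenerator_tauFunction_eq {p q : ℝ} (hp : p ≠ 0) (hq : q ≠ 0) (x : Positions n)
    (m : ℤ) (ξ : Config) :
    augmentedGenerator p q (tauFunction (p / q) x.1) m ξ =
      ∑ i, ((if StrictMono (x.1 - Pi.single i 1) then
          p * tauFunction (p / q) (x.1 - Pi.single i 1) m ξ - q * tauFunction (p / q) x.1 m ξ
          else 0)
        + (if StrictMono (x.1 + Pi.single i 1) then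
          q * tauFunction (p / q) (x.1 + Pi.single i 1) m ξ - p * tauFunction (p / q) x.1 m ξ
          else 0)) := by
  have h0 : p / q ≠ 0 := div_ne_zero hp hq
  have e1 : ∀ y, p * (p / q) ^ (-occ ξ y) - q = (q - p) * ((occ ξ y : ℝ) - 1) := by
    intro y
    unfold occ
    split_ifs
    · simp; field_simp; ring
    · simp
  have e2 : ∀ y, q * (p / q) ^ occ ξ y - p = (q - p) * (1 - (occ ξ y : ℝ)) := by
    intro y
    unfold occ
    split_ifs
    · simp; field_simp; ring
    · simp
  rw [augmentedGenerator_tauFunction hp hq x.2.injective,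
    ← sum_exclusion x.2.injective fun y => (occ ξ y : ℝ), Finset.mul_sum, Finset.mul_sum]
  refine Finset.sum_congr rfl fun i _ => ?_
  simp only [tauFunction_sub_single h0, tauFunction_add_single h0, strictMono_sub_single_iff x.2,
    strictMono_add_single_iff x.2, mul_add, mul_ite, mul_zero]
  congr 2
  · rw [← e1]; ring
  · rw [← e2]; ring

end TauFunction

end ASEP

theorem mainTheorem11 {Ω : Type*} {mΩ : MeasurableSpace Ω} (P : Measure Ω)
    [IsProbabilityMeasure P] (ℱ : Filtration ℝ≥0 mΩ) (η : ℝ≥0 → Ω → ASEP.Config)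
    (p q : ℝ) (hp : 0 < p) (hpq : p < q)
    (ρm ρp : ℝ) (hρm : ρm ∈ Icc (0 : ℝ) 1) (hρp : ρp ∈ Icc (0 : ℝ) 1)
    (hη : ASEP.IsASEP p q ℱ P η) (hinit : ASEP.IsTwoSidedBernoulli ρm ρp P (η 0)) (n : ℕ) :
    (∀ (x : ASEP.Positions n) (t : ℝ≥0),
      Integrable (fun ω => ASEP.tauProduct (p / q) (fun s => η s ω) x t) P) ∧
    ASEP.SatisfiesForwardEquations p q
      (fun x : ASEP.Positions n => ASEP.tauCorrelation (p / q) P η x) := by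
  classical
  have hq : 0 < q := hp.trans hpq
  have hτ0 : 0 < p / q := div_pos hp hq
  have hτ1 : p / q ≤ 1 := (div_le_one hq).2 hpq.le
  have hκ : 1 ≤ (p / q)⁻¹ ^ n := one_le_pow₀ ((one_le_inv₀ hτ0).2 hτ1)
  have hint : ∀ (x : Fin n → ℤ) (t : ℝ≥0), Integrable (fun ω =>
      ASEP.tauFunction (p / q) x (ASEP.current (fun s => η s ω) 0 t) (η t ω)) P := fun x t =>
    hη.integrable_current hp.le hq.le hκ (ASEP.isTempered_tauFunction hτ0 hτ1 x) t
  refine ⟨fun x t => hint x.1 t, fun x t => ?_⟩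
  have hd := hη.hasDerivWithinAt_mean hp.le hq.le hκ
    (ASEP.isTempered_tauFunction hτ0 hτ1 x.1) t
  suffices e : ∑ᶠ y : ASEP.Positions n, (ASEP.rate p q y x * ASEP.tauCorrelation (p / q) P η y t
      - ASEP.rate p q x y * ASEP.tauCorrelation (p / q) P η x t) =
      ASEP.mean P η (ASEP.augmentedGenerator p q (ASEP.tauFunction (p / q) x.1)) t by
    rw [← e] at hd
    exact hd
  have hφ : ∀ y : ASEP.Positions n, ASEP.tauCorrelation (p / q) P η y t =
      ∫ ω, ASEP.tauFunction (p / q) y.1 (ASEP.current (fun s => η s ω) 0 t) (η t ω) ∂P :=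
    fun _ => rfl
  -- The forward operator has finitely many terms, so it commutes with the expectation.
  have hcomb : ∀ (c : Prop) [Decidable c] (a b : ℝ) (x y : Fin n → ℤ),
      Integrable (fun ω => if c then
        a * ASEP.tauFunction (p / q) x (ASEP.current (fun s => η s ω) 0 t) (η t ω)
        - b * ASEP.tauFunction (p / q) y (ASEP.current (fun s => η s ω) 0 t) (η t ω) else 0) P ∧
      ∫ ω, (if c then
        a * ASEP.tauFunction (p / q) x (ASEP.current (fun s => η s ω) 0 t) (η t ω)
        - b * ASEP.tauFunction (p / q) y (ASEP.current (fun s => η s ω) 0 t) (η t ω) else 0) ∂P =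
      if c then
        a * ∫ ω, ASEP.tauFunction (p / q) x (ASEP.current (fun s => η s ω) 0 t) (η t ω) ∂P
        - b * ∫ ω, ASEP.tauFunction (p / q) y (ASEP.current (fun s => η s ω) 0 t) (η t ω) ∂P
      else 0 := by
    intro c _ a b x y
    split_ifs
    · exact ⟨((hint x t).const_mul a).sub ((hint y t).const_mul b), by
        rw [integral_sub ((hint x t).const_mul a) ((hint y t).const_mul b), integral_const_mul,
          integral_const_mul]⟩
    · simp
  rw [ASEP.finsum_rate p q (fun y => ASEP.tauCorrelation (p / q) P η y t), ASEP.mean]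
  simp only [ASEP.augmentedGenerator_tauFunction_eq hp.ne' hq.ne', hφ]
  rw [integral_finsetSum]
  · refine Finset.sum_congr rfl fun i _ => ?_
    rw [integral_add (hcomb _ p q _ _).1 (hcomb _ q p _ _).1, (hcomb _ p q _ _).2,
      (hcomb _ q p _ _).2]
    congr 1
  · exact fun i _ => (hcomb _ p q _ _).1.add (hcomb _ q p _ _).1
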